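/- Let $d\ge 2$, $Q_R=(-R/2,R/2)^d$ for $R>0$, and $Y=[-1/2,1/2]^d$. Let $T\subset\mathbb R^d$ be the closure of an open subset of $Y$ with Lipschitz boundary, and assume that $Y\setminus T$ is connected and that, for some $c_0>0$, $B(0,c_0)\subset T$ and $\operatorname{dist}(\partial T,\partial Y)\ge c_0$. For $0<\varepsilon\le 1$ and $0<\eta\le 1$ set $$\omega_{\varepsilon,\eta}=\mathbb R^d\setminus\bigcup_{k\in\mathbb Z^d}\varepsilon(k+\eta T).$$ There is a constant $C$ depending only on $d$ (in particular not on $T$, $c_0$, $\varepsilon$, $\eta$, $R$, $r$, $u$) such that the following holds. Let $R\ge\varepsilon$ and let $u\in W^{1,2}(Q_R)$ be real-valued and satisfy $$\Delta u=0\ \text{ (weakly) in } Q_R\cap\omega_{\varepsilon,\eta},\qquad u=0\ \text{ a.e. in } Q_R\setminus\omega_{\varepsilon,\eta}.$$ Then, for all $\varepsilon\le r\le R$, $$\Big(\frac1{|Q_r|}\int_{Q_r}|u|^2\,dx\Big)^{1/2}\le C\Big(\frac1{|Q_R|}\int_{Q_R}|u|^2\,dx\Big)^{1/2}.$$ -/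

import Mathlib

open MeasureTheory
open scoped ContDiff

namespace Perforated

/-- The open cube `Q_R = (-R/2, R/2)^d`. -/
def cube (d : ℕ) (R : ℝ) : Set (EuclideanSpace ℝ (Fin d)) :=
  {x | ∀ i, -(R / 2) < x i ∧ x i < R / 2}

/-- The closed unit cube `Y = [-1/2, 1/2]^d`. -/
def unitCell (d : ℕ) : Set (EuclideanSpace ℝ (Fin d)) :=
  {x | ∀ i, -(1 / 2) ≤ x i ∧ x i ≤ 1 / 2}

/-- An integer vector, viewed as a point of `ℝ^d`. -/
def latticePoint {d : ℕ} (k : Fin d → ℤ) : EuclideanSpace ℝ (Fin d) :=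
  WithLp.toLp 2 fun i => (k i : ℝ)

/-- The perforated space `ω_{ε,η} = ℝ^d \ ⋃_{k ∈ ℤ^d} ε (k + η T)`. -/
def perforated {d : ℕ} (T : Set (EuclideanSpace ℝ (Fin d))) (ε η : ℝ) :
    Set (EuclideanSpace ℝ (Fin d)) :=
  (⋃ k : Fin d → ℤ, (fun y => ε • (latticePoint k + η • y)) '' T)ᶜ

/-- The set `D` has Lipschitz boundary: near each boundary point `x₀` it is the part of a
ball lying above the graph of a Lipschitz function, in the direction of some unit vector `ν`.
The graph function `ψ` is evaluated only at `x - ⟪ν, x⟫ ν`, the orthogonal projection of `x`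
onto the hyperplane orthogonal to `ν`. -/
def HasLipschitzBoundary {d : ℕ} (D : Set (EuclideanSpace ℝ (Fin d))) : Prop :=
  ∀ x₀ ∈ frontier D, ∃ ρ > (0 : ℝ), ∃ ν : EuclideanSpace ℝ (Fin d), ‖ν‖ = 1 ∧
    ∃ (K : NNReal) (ψ : EuclideanSpace ℝ (Fin d) → ℝ), LipschitzWith K ψ ∧
      ∀ x ∈ Metric.ball x₀ ρ,
        (x ∈ D ↔ ψ (x - (inner ℝ ν x) • ν) < inner ℝ ν x)

/-- The assumptions on the reference hole `T`, with separation constant `c₀`. -/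
structure IsHole {d : ℕ} (c₀ : ℝ) (T : Set (EuclideanSpace ℝ (Fin d))) : Prop where
  /-- `T` is the closure of an open subset of `Y` with Lipschitz boundary. -/
  eq_closure : ∃ D : Set (EuclideanSpace ℝ (Fin d)),
    IsOpen D ∧ D ⊆ unitCell d ∧ HasLipschitzBoundary D ∧ T = closure D
  /-- `Y \ T` is connected. -/
  connected : IsConnected (unitCell d \ T)
  /-- `B(0, c₀) ⊆ T`. -/
  ball_subset : Metric.ball 0 c₀ ⊆ T
  /-- `dist(∂T, ∂Y) ≥ c₀`. -/
  dist_le : ∀ x ∈ frontier T, ∀ y ∈ frontier (unitCell d), c₀ ≤ dist x y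

/-- `φ ∈ C_c^∞(U)`. -/
def IsTestFunction {d : ℕ} (U : Set (EuclideanSpace ℝ (Fin d)))
    (φ : EuclideanSpace ℝ (Fin d) → ℝ) : Prop :=
  ContDiff ℝ ∞ φ ∧ HasCompactSupport φ ∧ tsupport φ ⊆ U

/-- `u ∈ W^{1,2}(U)`, with weak gradient `Du` in `U`. -/
structure MemW12 {d : ℕ} (U : Set (EuclideanSpace ℝ (Fin d)))
    (u : EuclideanSpace ℝ (Fin d) → ℝ)
    (Du : EuclideanSpace ℝ (Fin d) → EuclideanSpace ℝ (Fin d)) : Prop where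
  memLp : MemLp u 2 (volume.restrict U)
  memLp_grad : MemLp Du 2 (volume.restrict U)
  weak_grad : ∀ φ, IsTestFunction U φ → ∀ i : Fin d,
    ∫ x in U, u x * fderiv ℝ φ x (EuclideanSpace.single i 1) = -∫ x in U, Du x i * φ x

/-- The weak formulation of `Δu = 0` in `U`, in terms of the weak gradient `Du` of `u`:
`∫_U ∇u · ∇φ = 0` for all `φ ∈ C_c^∞(U)`. -/
def IsWeaklyHarmonic {d : ℕ} (U : Set (EuclideanSpace ℝ (Fin d)))
    (Du : EuclideanSpace ℝ (Fin d) → EuclideanSpace ℝ (Fin d)) : Prop :=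
  ∀ φ, IsTestFunction U φ → ∫ x in U, inner ℝ (Du x) (gradient φ x) = 0

end Perforated

/-!
Extended by zero across the holes, `u` has a weakly subharmonic square on the whole cube `Q_R`, and
averages of subharmonic functions over small cubes are controlled by averages over larger ones.
No property of the holes enters the constant; their geometry is only used qualitatively, to know
that `u φ` is an admissible test function in the equation for `u`.

*Admissibility.* The complement of the holes satisfies the cone condition `UniformConeAt` at every
point: near a boundary point of a hole it lies below a Lipschitz graph, and its points can be pushed
downwards, away from the hole (`uniformConeAt_perforated`). Hence a function
`w ∈ W^{1,2}` of small support vanishing on the holes can be mollified with bumps centred at `t ν`,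
of radius proportional to `t`, so that the results are test functions supported off the holes.
Passing to the limit `t → 0` requires only the continuity of `y ↦ ∫ a(x) b(x - y) dx` for
`a, b ∈ L²` (`weak_identity_of_cone`). A partition of unity removes the smallness of the support
(`integral_inner_test_mul_eq_zero`).

*Subharmonicity.* Testing the equation with `u φ`, for `φ ≥ 0`, gives
`∫ u ∇u · ∇φ = -∫ |∇u|² φ ≤ 0`, that is `∫_{Q_R} u² Δφ ≥ 0`
(`integral_sq_mul_laplacian_nonneg`).

*Averages.* An explicit radial `φ ≥ 0` supported in `Q_R` satisfies `Δφ ≤ C R^{-d}` everywhere and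
`Δφ ≤ -c r^{-d}` on `Q_r`, provided `2 d r ≤ R` (`exists_testFunction_laplacian`). Inserting it in
the last inequality compares the averages of `u²` over `Q_r` and `Q_R`; for larger `r` the
comparison is trivial.
-/

namespace Perforated

open Filter Topology Metric Set

variable {d : ℕ}

/-! ### Mollification of square integrable functions -/

theorem memLp_apply {μ : Measure (EuclideanSpace ℝ (Fin d))}
    {g : EuclideanSpace ℝ (Fin d) → EuclideanSpace ℝ (Fin d)} (hg : MemLp g 2 μ) (i : Fin d) :
    MemLp (fun x => g x i) 2 μ :=
  hg.norm.of_le ((EuclideanSpace.proj i : EuclideanSpace ℝ (Fin d) →L[ℝ] ℝ).continuous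
    |>.comp_aestronglyMeasurable hg.aestronglyMeasurable)
    (ae_of_all _ fun x => by simpa using PiLp.norm_apply_le (g x) i)

/-- This is the continuity of translations in `L²`. -/
theorem continuous_integral_mul_comp_sub {a b : EuclideanSpace ℝ (Fin d) → ℝ}
    (ha : MemLp a 2) (hb : MemLp b 2) :
    Continuous fun y => ∫ x, a x * b (x - y) := by
  have hmp : ∀ y : EuclideanSpace ℝ (Fin d),
      MeasurePreserving (fun x : EuclideanSpace ℝ (Fin d) => x - y) volume volume :=
    fun y => measurePreserving_sub_right volume y
  let g : C(EuclideanSpace ℝ (Fin d), C(EuclideanSpace ℝ (Fin d), EuclideanSpace ℝ (Fin d))) :=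
    (ContinuousMap.mk (fun p : EuclideanSpace ℝ (Fin d) × EuclideanSpace ℝ (Fin d) => p.2 - p.1)
      (by fun_prop)).curry
  have hc : Continuous fun y => Lp.compMeasurePreserving (g y) (hmp y) (hb.toLp b) :=
    (continuous_const (y := hb.toLp b)).compMeasurePreservingLp g.continuous hmp (by simp)
  have hc' : Continuous fun y =>
      inner ℝ (ha.toLp a) (Lp.compMeasurePreserving (g y) (hmp y) (hb.toLp b)) :=
    continuous_const.inner hc
  refine hc'.congr fun y => ?_
  rw [L2.inner_def]
  refine integral_congr_ae ?_
  have h1 := Lp.coeFn_compMeasurePreserving (hb.toLp b) (hmp y)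
  have h2 : (hb.toLp b) ∘ (fun x => x - y) =ᵐ[volume] b ∘ (fun x => x - y) :=
    (hmp y).quasiMeasurePreserving.ae_eq hb.coeFn_toLp
  filter_upwards [ha.coeFn_toLp, h1, h2] with x hx1 hx2 hx3
  have : (Lp.compMeasurePreserving (g y) (hmp y) (hb.toLp b)) x = b (x - y) := hx2.trans hx3
  rw [this, hx1]
  simp [mul_comm]

/-- The integrability needed for Fubini's theorem, by `|a b| ≤ a² + b²`. -/
theorem integrable_prod_mul_comp_sub {a b k : EuclideanSpace ℝ (Fin d) → ℝ}
    (ha : MemLp a 2) (hb : MemLp b 2) (hk : Integrable k) :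
    Integrable (fun p : EuclideanSpace ℝ (Fin d) × EuclideanSpace ℝ (Fin d) =>
      a p.1 * (k p.2 * b (p.1 - p.2))) (volume.prod volume) := by
  have hm : AEStronglyMeasurable (fun p : EuclideanSpace ℝ (Fin d) × EuclideanSpace ℝ (Fin d) =>
      k p.2 * b (p.1 - p.2)) (volume.prod volume) :=
    hk.aestronglyMeasurable.convolution_integrand (ContinuousLinearMap.mul ℝ ℝ)
      hb.aestronglyMeasurable
  have h1 : Integrable (fun p : EuclideanSpace ℝ (Fin d) × EuclideanSpace ℝ (Fin d) =>
      (a p.1) ^ 2 * |k p.2|) (volume.prod volume) := ha.integrable_sq.mul_prod hk.abs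
  have h2 : Integrable (fun p : EuclideanSpace ℝ (Fin d) × EuclideanSpace ℝ (Fin d) =>
      |k p.2| * (b (p.1 - p.2)) ^ 2) (volume.prod volume) :=
    hk.abs.convolution_integrand (ContinuousLinearMap.mul ℝ ℝ) hb.integrable_sq
  refine (h1.add h2).mono' (ha.aestronglyMeasurable.comp_fst.mul hm) (ae_of_all _ fun p => ?_)
  simp only [Real.norm_eq_abs, abs_mul, Pi.add_apply]
  have h3 := sq_nonneg (|a p.1| - |b (p.1 - p.2)|)
  have h4 := sq_abs (a p.1)
  have h5 := sq_abs (b (p.1 - p.2))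
  have h6 : |a p.1| * |b (p.1 - p.2)| ≤ a p.1 ^ 2 + b (p.1 - p.2) ^ 2 := by
    nlinarith [mul_nonneg (abs_nonneg (a p.1)) (abs_nonneg (b (p.1 - p.2)))]
  calc |a p.1| * (|k p.2| * |b (p.1 - p.2)|) = |k p.2| * (|a p.1| * |b (p.1 - p.2)|) := by ring
    _ ≤ |k p.2| * (a p.1 ^ 2 + b (p.1 - p.2) ^ 2) := by gcongr
    _ = _ := by ring

theorem integral_mul_comp_sub_eq (w k : EuclideanSpace ℝ (Fin d) → ℝ)
    (x : EuclideanSpace ℝ (Fin d)) :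
    ∫ t, w t * k (x - t) = ∫ y, k y * w (x - y) := by
  rw [← integral_sub_left_eq_self (fun y => k y * w (x - y)) volume x]
  simp [mul_comm]

theorem integrable_mul_mollify {a b k : EuclideanSpace ℝ (Fin d) → ℝ}
    (ha : MemLp a 2) (hb : MemLp b 2) (hk : Integrable k) :
    Integrable fun x => a x * ∫ t, b t * k (x - t) := by
  have := (integrable_prod_mul_comp_sub ha hb hk).integral_prod_left
  simpa only [integral_mul_comp_sub_eq, integral_const_mul] using this

theorem integral_mul_mollify {a b k : EuclideanSpace ℝ (Fin d) → ℝ}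
    (ha : MemLp a 2) (hb : MemLp b 2) (hk : Integrable k) :
    ∫ x, a x * ∫ t, b t * k (x - t) = ∫ y, k y * ∫ x, a x * b (x - y) := by
  have := integral_integral_swap (f := fun x y => a x * (k y * b (x - y)))
    (integrable_prod_mul_comp_sub ha hb hk)
  simp only [integral_mul_comp_sub_eq, integral_const_mul] at this ⊢
  rw [this]
  simp only [← integral_const_mul]
  refine integral_congr_ae (ae_of_all _ fun y => integral_congr_ae (ae_of_all _ fun x => ?_))
  ring

theorem contDiff_mollify {w k : EuclideanSpace ℝ (Fin d) → ℝ} (hw : MemLp w 2)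
    (hk : ContDiff ℝ ∞ k) (hkc : HasCompactSupport k) :
    ContDiff ℝ ∞ fun x => ∫ t, w t * k (x - t) :=
  hkc.contDiff_convolution_right (ContinuousLinearMap.mul ℝ ℝ)
    (hw.locallyIntegrable (by norm_num)) hk

/-- Mollification commutes with weak differentiation. -/
theorem fderiv_mollify {w : EuclideanSpace ℝ (Fin d) → ℝ}
    {G : EuclideanSpace ℝ (Fin d) → EuclideanSpace ℝ (Fin d)} (hw : MemW12 univ w G)
    {k : EuclideanSpace ℝ (Fin d) → ℝ} (hk : ContDiff ℝ ∞ k) (hkc : HasCompactSupport k)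
    (x : EuclideanSpace ℝ (Fin d)) (i : Fin d) :
    fderiv ℝ (fun x => ∫ t, w t * k (x - t)) x (EuclideanSpace.single i 1) =
      ∫ t, G t i * k (x - t) := by
  have hw2 : MemLp w 2 := by simpa using hw.memLp
  have hk1 : ContDiff ℝ 1 k := hk.of_le (by simp)
  have h1 := hkc.hasFDerivAt_convolution_right (ContinuousLinearMap.mul ℝ ℝ)
    (hw2.locallyIntegrable (by norm_num)) hk1 x
  have h2 : fderiv ℝ (fun x => ∫ t, w t * k (x - t)) x = _ := h1.fderiv
  rw [h2, convolution_precompR_apply (ContinuousLinearMap.mul ℝ ℝ)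
    (hw2.locallyIntegrable (by norm_num)) (hkc.fderiv ℝ) (hk1.continuous_fderiv (by simp))]
  have htest : IsTestFunction univ (fun t => k (x - t)) :=
    ⟨hk.comp (contDiff_const.sub contDiff_id),
      hkc.comp_homeomorph (Homeomorph.subLeft x), subset_univ _⟩
  have h3 := hw.weak_grad _ htest i
  have h4 : ∀ t, fderiv ℝ (fun t => k (x - t)) t (EuclideanSpace.single i 1) =
      - fderiv ℝ k (x - t) (EuclideanSpace.single i 1) := by
    intro t
    rw [show (fun t => k (x - t)) = k ∘ (fun t => x - t) from rfl,
      fderiv_comp t (hk1.differentiable (by simp) _) (by fun_prop),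
      show fderiv ℝ (fun t => x - t) t = _ from ((hasFDerivAt_id t).const_sub x).fderiv]
    simp
  simp only [h4, mul_neg, Measure.restrict_univ, integral_neg, neg_inj] at h3
  rw [← h3]
  rfl

/-! ### Admissible test functions -/

/-- A continuous function whose averages against normalized bumps concentrating at the origin
vanish is zero at the origin. -/
theorem eq_zero_of_integral_normed_mul_eq_zero {F : EuclideanSpace ℝ (Fin d) → ℝ}
    (hF : Continuous F)
    (h : ∀ ρ > 0, ∃ (c : EuclideanSpace ℝ (Fin d)) (f : ContDiffBump c),
      closedBall c f.rOut ⊆ ball 0 ρ ∧ ∫ y, f.normed volume y * F y = 0) :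
    F 0 = 0 := by
  by_contra hne
  obtain ⟨ρ, hρ, hρF⟩ := Metric.continuous_iff.1 hF 0 |F 0| (abs_pos.2 hne)
  obtain ⟨c, f, hsub, hint⟩ := h ρ hρ
  -- On the support of the bump the integrand has the strict sign of `F 0`.
  have hpos : ∀ y ∈ ball c f.rOut, 0 < F 0 * F y := by
    intro y hy
    have h1 : dist (F y) (F 0) < |F 0| := hρF y (hsub (ball_subset_closedBall hy))
    rw [Real.dist_eq] at h1
    have h2 := sq_lt_sq.2 (by rwa [abs_abs] : |F y - F 0| < |(|F 0|)|)
    rw [sq_abs] at h2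
    nlinarith [sq_nonneg (F y)]
  have hint' : ∫ y, f.normed volume y * (F 0 * F y) = 0 := by
    have : ∀ y, f.normed volume y * (F 0 * F y) = F 0 * (f.normed volume y * F y) := fun y => by
      ring
    simp only [this, integral_const_mul, hint, mul_zero]
  have hnn : ∀ y, 0 ≤ f.normed volume y * (F 0 * F y) := by
    intro y
    by_cases hy : y ∈ ball c f.rOut
    · exact mul_nonneg (f.nonneg_normed y) (hpos y hy).le
    · have : f.normed volume y = 0 := by
        rw [← f.support_normed_eq (μ := volume)] at hy
        simpa using hy
      simp [this]
  have hcont : Continuous fun y => f.normed volume y * (F 0 * F y) :=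
    f.continuous_normed.mul (continuous_const.mul hF)
  have hz := hcont.ae_eq_iff_eq volume continuous_const |>.1
    ((integral_eq_zero_iff_of_nonneg hnn (hcont.integrable_of_hasCompactSupport
      (f.hasCompactSupport_normed.mul_right))).1 hint')
  have hc := congrFun hz c
  have hcs : c ∈ Function.support (f.normed volume) := by
    rw [f.support_normed_eq]; exact mem_ball_self f.rOut_pos
  have := hpos c (mem_ball_self f.rOut_pos)
  exact (mul_ne_zero hcs this.ne') hc

/-- The weak identity `∫ (A₀ φ + A · ∇φ) = 0` for test functions `φ` in `U` extends to those
`w ∈ W^{1,2}(ℝ^d)` that vanish outside a bounded set which can be pushed into `U`, with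
room to spare, by arbitrarily small translations along a fixed direction `ν`: the shifted
mollifications of `w` are test functions in `U`. -/
theorem weak_identity_of_cone {U : Set (EuclideanSpace ℝ (Fin d))}
    {A₀ : EuclideanSpace ℝ (Fin d) → ℝ} {A : Fin d → EuclideanSpace ℝ (Fin d) → ℝ}
    (hA₀ : MemLp A₀ 2) (hA : ∀ i, MemLp (A i) 2)
    (h : ∀ φ, IsTestFunction U φ →
      ∫ x, (A₀ x * φ x + ∑ i, A i x * fderiv ℝ φ x (EuclideanSpace.single i 1)) = 0)
    {w : EuclideanSpace ℝ (Fin d) → ℝ}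
    {G : EuclideanSpace ℝ (Fin d) → EuclideanSpace ℝ (Fin d)} (hw : MemW12 univ w G)
    {S : Set (EuclideanSpace ℝ (Fin d))} (hS : Bornology.IsBounded S)
    (hwS : ∀ᵐ x, x ∉ S → w x = 0) {ν : EuclideanSpace ℝ (Fin d)} {δ t₀ : ℝ} (hδ : 0 < δ)
    (ht₀ : 0 < t₀) (hU : ∀ x ∈ S, ∀ t ∈ Ioo 0 t₀, closedBall (x + t • ν) (δ * t) ⊆ U) :
    ∫ x, (A₀ x * w x + ∑ i, A i x * G x i) = 0 := by
  have hw2 : MemLp w 2 := by simpa using hw.memLp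
  have hG2 : MemLp G 2 := by simpa using hw.memLp_grad
  have hGi : ∀ i, MemLp (fun x => G x i) 2 := memLp_apply hG2
  have hmul : ∀ {a b : EuclideanSpace ℝ (Fin d) → ℝ}, MemLp a 2 → MemLp b 2 → ∀ y,
      Integrable fun x => a x * b (x - y) := fun ha hb y =>
    ha.integrable_mul (hb.comp_measurePreserving (measurePreserving_sub_right volume y))
  -- The claim is `F 0 = 0`; the equation, tested with shifted mollifications of `w`, shows that
  -- suitable averages of `F` near the origin vanish.
  set F : EuclideanSpace ℝ (Fin d) → ℝ := fun y =>
    ∫ x, (A₀ x * w (x - y) + ∑ i, A i x * G (x - y) i) with hFdef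
  have hFsum : ∀ y, F y =
      (∫ x, A₀ x * w (x - y)) + ∑ i, ∫ x, A i x * G (x - y) i := by
    intro y
    rw [hFdef]
    simp only
    rw [integral_add (hmul hA₀ hw2 y) (integrable_finsetSum _ fun i _ => hmul (hA i) (hGi i) y),
      integral_finsetSum _ fun i _ => hmul (hA i) (hGi i) y]
  have hF : Continuous F := by
    rw [show F = _ from funext hFsum]
    exact (continuous_integral_mul_comp_sub hA₀ hw2).add
      (continuous_finsetSum _ fun i _ => continuous_integral_mul_comp_sub (hA i) (hGi i))
  suffices h0 : F 0 = 0 by simpa [hFdef] using h0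
  refine eq_zero_of_integral_normed_mul_eq_zero hF fun ρ hρ => ?_
  obtain ⟨t, ht, htt₀, htρ⟩ : ∃ t, 0 < t ∧ t < t₀ ∧ t * (‖ν‖ + δ) < ρ := by
    refine ⟨min (t₀ / 2) (ρ / (2 * (‖ν‖ + δ))), by positivity, ?_, ?_⟩
    · exact (min_le_left _ _).trans_lt (by linarith)
    · calc _ ≤ ρ / (2 * (‖ν‖ + δ)) * (‖ν‖ + δ) := by gcongr; exact min_le_right _ _
        _ = ρ / 2 := by field_simp
        _ < ρ := by linarith
  let f : ContDiffBump (t • ν) := ⟨δ * t / 4, δ * t / 2, by positivity, by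
    have : 0 < δ * t := by positivity
    linarith⟩
  have hfr : f.rOut = δ * t / 2 := rfl
  have hδt : 0 < δ * t := by positivity
  refine ⟨t • ν, f, ?_, ?_⟩
  · intro y hy
    rw [mem_closedBall, hfr, dist_eq_norm] at hy
    rw [mem_ball_zero_iff]
    calc ‖y‖ = ‖(y - t • ν) + t • ν‖ := by simp
      _ ≤ ‖y - t • ν‖ + ‖t • ν‖ := norm_add_le _ _
      _ ≤ δ * t / 2 + t * ‖ν‖ := by
        rw [norm_smul, Real.norm_eq_abs, abs_of_pos ht]; gcongr
      _ < ρ := by nlinarith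
  · set k := f.normed volume with hkdef
    have hk : ContDiff ℝ ∞ k := f.contDiff_normed
    have hkc : HasCompactSupport k := f.hasCompactSupport_normed
    have hki : Integrable k := f.integrable_normed
    set φ : EuclideanSpace ℝ (Fin d) → ℝ := fun x => ∫ s, w s * k (x - s) with hφdef
    -- The support of the mollification lies in `S + closedBall (t ν) (δ t / 2)`.
    have hsupp : Function.support φ ⊆ cthickening (δ * t / 2) ((fun x => x + t • ν) '' S) := by
      intro x hx
      by_contra hxn
      refine hx (integral_eq_zero_of_ae ?_)
      filter_upwards [hwS] with s hs
      by_cases hsS : s ∈ S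
      · have : k (x - s) = 0 := by
          have h1 : x - s ∉ Function.support k := by
            rw [hkdef, f.support_normed_eq, mem_ball, hfr, not_lt]
            by_contra! hlt
            refine hxn (mem_cthickening_of_dist_le x (s + t • ν) _ _ ⟨s, hsS, rfl⟩ ?_)
            rw [dist_eq_norm] at hlt ⊢
            rw [← sub_sub]
            exact hlt.le
          simpa using h1
        simp [this]
      · simp [hs hsS]
    have hts : tsupport φ ⊆ cthickening (δ * t / 2) ((fun x => x + t • ν) '' S) :=
      closure_minimal hsupp isClosed_cthickening
    have hbd : Bornology.IsBounded ((fun x => x + t • ν) '' S) := by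
      obtain ⟨r, hr⟩ := hS.subset_closedBall 0
      refine (isBounded_closedBall (x := t • ν) (r := r)).subset ?_
      rintro _ ⟨x, hx, rfl⟩
      simpa [dist_eq_norm] using hr hx
    have htest : IsTestFunction U φ := by
      refine ⟨contDiff_mollify hw2 hk hkc, ?_, ?_⟩
      · exact (hbd.cthickening.isCompact_closure).of_isClosed_subset (isClosed_tsupport _)
          (hts.trans subset_closure)
      · intro x hx
        have h1 := cthickening_subset_thickening' hδt (by linarith : δ * t / 2 < δ * t) _ (hts hx)
        obtain ⟨_, ⟨s, hs, rfl⟩, hxs⟩ := mem_thickening_iff.1 h1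
        exact hU s hs t ⟨ht, htt₀⟩ (mem_closedBall.2 hxs.le)
    have h1 := h φ htest
    have h2 : ∀ x i, fderiv ℝ φ x (EuclideanSpace.single i 1) = ∫ s, G s i * k (x - s) :=
      fun x i => fderiv_mollify hw hk hkc x i
    simp only [h2] at h1
    rw [integral_add (integrable_mul_mollify hA₀ hw2 hki)
      (integrable_finsetSum _ fun i _ => integrable_mul_mollify (hA i) (hGi i) hki),
      integral_finsetSum _ fun i _ => integrable_mul_mollify (hA i) (hGi i) hki,
      integral_mul_mollify hA₀ hw2 hki] at h1
    simp only [fun i => integral_mul_mollify (hA i) (hGi i) hki] at h1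
    have hki' : ∀ {g : EuclideanSpace ℝ (Fin d) → ℝ}, Continuous g →
        Integrable fun y => k y * g y := fun hg =>
      (hk.continuous.mul hg).integrable_of_hasCompactSupport hkc.mul_right
    simp only [hFsum, mul_add, Finset.mul_sum]
    rw [integral_add (hki' (continuous_integral_mul_comp_sub hA₀ hw2))
      (integrable_finsetSum _ fun i _ => hki' (continuous_integral_mul_comp_sub (hA i) (hGi i))),
      integral_finsetSum _ fun i _ => hki' (continuous_integral_mul_comp_sub (hA i) (hGi i))]
    exact h1

/-! ### Products of Sobolev functions with test functions -/

theorem gradient_apply_eq_fderiv (φ : EuclideanSpace ℝ (Fin d) → ℝ)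
    (x : EuclideanSpace ℝ (Fin d)) (i : Fin d) :
    gradient φ x i = fderiv ℝ φ x (EuclideanSpace.single i 1) := by
  have h : inner ℝ (gradient φ x) (EuclideanSpace.single i (1 : ℝ)) =
      fderiv ℝ φ x (EuclideanSpace.single i 1) := InnerProductSpace.toDual_symm_apply
  rw [← h, EuclideanSpace.inner_single_right]
  simp

theorem inner_eq_sum_mul (v w : EuclideanSpace ℝ (Fin d)) :
    inner ℝ v w = ∑ i, v i * w i := by
  rw [PiLp.inner_apply]
  exact Finset.sum_congr rfl fun i _ => by simp [mul_comm]

namespace IsTestFunction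

variable {V : Set (EuclideanSpace ℝ (Fin d))} {φ ψ : EuclideanSpace ℝ (Fin d) → ℝ}

theorem contDiff_mul (h : IsTestFunction V φ) (hψ : ContDiff ℝ ∞ ψ) :
    IsTestFunction V fun x => φ x * ψ x :=
  ⟨h.1.mul hψ, h.2.1.mul_right, (tsupport_mul_subset_left).trans h.2.2⟩

theorem differentiable (h : IsTestFunction V φ) : Differentiable ℝ φ :=
  h.1.differentiable (by simp)

theorem eq_zero (h : IsTestFunction V φ) {x : EuclideanSpace ℝ (Fin d)} (hx : x ∉ V) :
    φ x = 0 :=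
  image_eq_zero_of_notMem_tsupport fun hx' => hx (h.2.2 hx')

theorem fderiv_apply (h : IsTestFunction V φ) (v : EuclideanSpace ℝ (Fin d)) :
    IsTestFunction V fun x => fderiv ℝ φ x v := by
  refine ⟨(h.1.fderiv_right (m := ∞) (by simp)).clm_apply contDiff_const, ?_, ?_⟩
  · exact h.2.1.fderiv_apply ℝ v
  · exact (tsupport_fderiv_apply_subset ℝ v).trans h.2.2

theorem exists_bound (h : IsTestFunction V φ) : ∃ C, ∀ x, |φ x| ≤ C :=
  h.2.1.exists_bound_of_continuous h.1.continuous

end IsTestFunction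

theorem memLp_of_norm_le_mul {F F' : Type*} [NormedAddCommGroup F] [NormedAddCommGroup F']
    {V : Set (EuclideanSpace ℝ (Fin d))} (hV : MeasurableSet V)
    {g : EuclideanSpace ℝ (Fin d) → F} (hg : MemLp g 2 (volume.restrict V))
    {h : EuclideanSpace ℝ (Fin d) → F'} (hm : AEStronglyMeasurable h (volume.restrict V))
    (hsupp : ∀ x ∉ V, h x = 0) {C : ℝ} (hC : ∀ x, ‖h x‖ ≤ C * ‖g x‖) : MemLp h 2 := by
  have h1 : MemLp h 2 (volume.restrict V) := hg.of_le_mul hm (ae_of_all _ hC)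
  have h2 : V.indicator h = h := by
    rw [indicator_eq_self]
    intro x hx
    by_contra hxV
    exact hx (hsupp x hxV)
  rwa [← memLp_indicator_iff_restrict hV, h2] at h1

theorem IsTestFunction.integrableOn_mul {V : Set (EuclideanSpace ℝ (Fin d))}
    {g φ : EuclideanSpace ℝ (Fin d) → ℝ} (hφ : IsTestFunction V φ)
    (hg : MemLp g 2 (volume.restrict V)) : IntegrableOn (fun x => g x * φ x) V :=
  hg.integrable_mul
    (((hφ.1.continuous.memLp_of_hasCompactSupport hφ.2.1 : MemLp φ 2)).restrict V)

theorem IsTestFunction.norm_gradient_le {V : Set (EuclideanSpace ℝ (Fin d))}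
    {φ : EuclideanSpace ℝ (Fin d) → ℝ} (hφ : IsTestFunction V φ) :
    ∃ C, ∀ x, ‖gradient φ x‖ ≤ C := by
  obtain ⟨C, hC⟩ := (hφ.2.1.fderiv ℝ).exists_bound_of_continuous
    (hφ.1.continuous_fderiv (by simp))
  refine ⟨C, fun x => ?_⟩
  rw [gradient, LinearIsometryEquiv.norm_map]
  exact hC x

theorem IsTestFunction.continuous_gradient {V : Set (EuclideanSpace ℝ (Fin d))}
    {φ : EuclideanSpace ℝ (Fin d) → ℝ} (hφ : IsTestFunction V φ) :
    Continuous (gradient φ) :=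
  (LinearIsometryEquiv.continuous _).comp (hφ.1.continuous_fderiv (by simp))

theorem IsTestFunction.gradient_eq_zero {V : Set (EuclideanSpace ℝ (Fin d))}
    {φ : EuclideanSpace ℝ (Fin d) → ℝ} (hφ : IsTestFunction V φ)
    {x : EuclideanSpace ℝ (Fin d)} (hx : x ∉ V) : gradient φ x = 0 := by
  ext i
  rw [gradient_apply_eq_fderiv]
  simpa using (hφ.fderiv_apply (EuclideanSpace.single i 1)).eq_zero hx

/-- A Sobolev function on `V`, multiplied by a test function of `V`, is a Sobolev function on the
whole space, with the gradient given by the product rule. -/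
theorem MemW12.test_mul {V : Set (EuclideanSpace ℝ (Fin d))} (hV : MeasurableSet V)
    {u : EuclideanSpace ℝ (Fin d) → ℝ}
    {Du : EuclideanSpace ℝ (Fin d) → EuclideanSpace ℝ (Fin d)} (hu : MemW12 V u Du)
    {ψ : EuclideanSpace ℝ (Fin d) → ℝ} (hψ : IsTestFunction V ψ) :
    MemW12 univ (fun x => ψ x * u x) (fun x => ψ x • Du x + u x • gradient ψ x) := by
  obtain ⟨C, hC⟩ := hψ.exists_bound
  obtain ⟨C', hC'⟩ := hψ.norm_gradient_le
  refine ⟨?_, ?_, ?_⟩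
  · rw [Measure.restrict_univ]
    refine memLp_of_norm_le_mul hV hu.memLp (C := C)
      (hψ.1.continuous.aestronglyMeasurable.mul hu.memLp.aestronglyMeasurable)
      (fun x hx => by rw [hψ.eq_zero hx, zero_mul]) (fun x => ?_)
    rw [norm_mul]
    exact mul_le_mul_of_nonneg_right (hC x) (norm_nonneg _)
  · rw [Measure.restrict_univ]
    refine MemLp.add (memLp_of_norm_le_mul hV hu.memLp_grad (C := C)
      (hψ.1.continuous.aestronglyMeasurable.smul hu.memLp_grad.aestronglyMeasurable)
      (fun x hx => by rw [hψ.eq_zero hx, zero_smul]) (fun x => ?_))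
      (memLp_of_norm_le_mul hV hu.memLp (C := C')
      (hu.memLp.aestronglyMeasurable.smul hψ.continuous_gradient.aestronglyMeasurable)
      (fun x hx => by rw [hψ.gradient_eq_zero hx, smul_zero]) (fun x => ?_))
    · rw [norm_smul]
      exact mul_le_mul_of_nonneg_right (hC x) (norm_nonneg _)
    · rw [norm_smul, mul_comm]
      exact mul_le_mul_of_nonneg_right (hC' x) (norm_nonneg _)
  · intro ζ hζ i
    have hψi := hψ.fderiv_apply (EuclideanSpace.single i 1)
    have hζi := hζ.fderiv_apply (EuclideanSpace.single i 1)
    have h1 := hu.weak_grad _ (hψ.contDiff_mul hζ.1) i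
    have h2 : ∀ x, fderiv ℝ (fun x => ψ x * ζ x) x (EuclideanSpace.single i 1) =
        ψ x * fderiv ℝ ζ x (EuclideanSpace.single i 1) +
          fderiv ℝ ψ x (EuclideanSpace.single i 1) * ζ x := by
      intro x
      rw [fderiv_fun_mul hψ.differentiable.differentiableAt hζ.differentiable.differentiableAt]
      simp [mul_comm]
    simp only [h2, mul_add] at h1
    rw [integral_add ((hψ.contDiff_mul hζi.1).integrableOn_mul hu.memLp)
      ((hψi.contDiff_mul hζ.1).integrableOn_mul hu.memLp)] at h1
    simp only [Measure.restrict_univ]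
    have h5 : ∫ x, ψ x * u x * fderiv ℝ ζ x (EuclideanSpace.single i 1) =
        ∫ x in V, ψ x * u x * fderiv ℝ ζ x (EuclideanSpace.single i 1) :=
      (setIntegral_eq_integral_of_forall_compl_eq_zero
        (fun x hx => by rw [hψ.eq_zero hx]; simp)).symm
    have h6 : ∫ x, (ψ x • Du x + u x • gradient ψ x) i * ζ x =
        ∫ x in V, (ψ x • Du x + u x • gradient ψ x) i * ζ x :=
      (setIntegral_eq_integral_of_forall_compl_eq_zero
        (fun x hx => by rw [hψ.eq_zero hx, hψ.gradient_eq_zero hx]; simp)).symm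
    rw [h5, h6]
    have h3 : ∀ x, (ψ x • Du x + u x • gradient ψ x) i * ζ x =
        Du x i * (ψ x * ζ x) + u x * (fderiv ℝ ψ x (EuclideanSpace.single i 1) * ζ x) := by
      intro x
      simp only [PiLp.add_apply, PiLp.smul_apply, smul_eq_mul, gradient_apply_eq_fderiv]
      ring
    simp only [h3]
    rw [integral_add ((hψ.contDiff_mul hζ.1).integrableOn_mul (memLp_apply hu.memLp_grad i))
      ((hψi.contDiff_mul hζ.1).integrableOn_mul hu.memLp)]
    have h4 : ∀ x, ψ x * u x * fderiv ℝ ζ x (EuclideanSpace.single i 1) =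
      u x * (ψ x * fderiv ℝ ζ x (EuclideanSpace.single i 1)) := fun x => by ring
    simp only [h4]
    linarith

/-! ### Subharmonicity of the square -/

/-- The cone condition for `U` at `x₀`: near `x₀`, the points of `U` can be pushed along one and
the same direction `ν`, staying at a distance from the complement proportional to the shift. The
value `ν = 0` is allowed and is the right one at points interior to `U`. -/
def UniformConeAt (U : Set (EuclideanSpace ℝ (Fin d))) (x₀ : EuclideanSpace ℝ (Fin d)) : Prop :=
  ∃ ρ > (0 : ℝ), ∃ ν : EuclideanSpace ℝ (Fin d), ∃ δ > (0 : ℝ), ∃ t₀ > (0 : ℝ),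
    ∀ x ∈ ball x₀ ρ ∩ U, ∀ t ∈ Ioo 0 t₀, closedBall (x + t • ν) (δ * t) ⊆ U

/-- The identity `∫ ∂ᵢ(u²) ψ + u² ∂ᵢψ = 0`, where `∂ᵢ(u²) = 2 u ∂ᵢu`. It is the weak definition of
`∂ᵢu` with `u ψ` in the role of the test function. -/
theorem MemW12.integral_sq_mul_fderiv {V : Set (EuclideanSpace ℝ (Fin d))} (hV : IsOpen V)
    {u : EuclideanSpace ℝ (Fin d) → ℝ}
    {Du : EuclideanSpace ℝ (Fin d) → EuclideanSpace ℝ (Fin d)} (hu : MemW12 V u Du)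
    {ψ : EuclideanSpace ℝ (Fin d) → ℝ} (hψ : IsTestFunction V ψ) (i : Fin d) :
    ∫ x in V, (2 * (u x * Du x i * ψ x) +
      u x ^ 2 * fderiv ℝ ψ x (EuclideanSpace.single i 1)) = 0 := by
  obtain ⟨δ, hδ, hδV⟩ := hψ.2.1.isCompact.exists_cthickening_subset_open hV hψ.2.2
  have key := weak_identity_of_cone (U := V) (A₀ := V.indicator fun x => Du x i)
    (A := fun j => if j = i then V.indicator u else 0)
    ((memLp_indicator_iff_restrict hV.measurableSet).2 (memLp_apply hu.memLp_grad i))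
    (fun j => by
      split_ifs
      · exact (memLp_indicator_iff_restrict hV.measurableSet).2 hu.memLp
      · exact MemLp.zero)
    (fun φ hφ => ?_) (hu.test_mul hV.measurableSet hψ) (S := tsupport ψ)
    hψ.2.1.isCompact.isBounded
    (ae_of_all _ fun x hx => by rw [image_eq_zero_of_notMem_tsupport hx, zero_mul])
    (ν := 0) one_pos hδ (fun x hx t ht => ?_)
  · have hsum : ∀ x, (V.indicator (fun x => Du x i) x * (ψ x * u x) +
        ∑ j, (if j = i then V.indicator u else 0) x *
          (ψ x • Du x + u x • gradient ψ x) j) =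
        V.indicator (fun x => 2 * (u x * Du x i * ψ x) +
          u x ^ 2 * fderiv ℝ ψ x (EuclideanSpace.single i 1)) x := by
      intro x
      rw [Finset.sum_eq_single i (fun j _ hj => by simp [hj]) (by simp)]
      by_cases hx : x ∈ V
      · simp [hx, gradient_apply_eq_fderiv]; ring
      · simp [hx]
    simp only [hsum] at key
    rwa [integral_indicator hV.measurableSet] at key
  · have hsum : ∀ x, (V.indicator (fun x => Du x i) x * φ x +
        ∑ j, (if j = i then V.indicator u else 0) x *
          fderiv ℝ φ x (EuclideanSpace.single j 1)) =
        V.indicator (fun x => Du x i * φ x +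
          u x * fderiv ℝ φ x (EuclideanSpace.single i 1)) x := by
      intro x
      rw [Finset.sum_eq_single i (fun j _ hj => by simp [hj]) (by simp)]
      by_cases hx : x ∈ V <;> simp [hx]
    simp only [hsum]
    rw [integral_indicator hV.measurableSet,
      integral_add (hφ.integrableOn_mul (memLp_apply hu.memLp_grad i))
        ((hφ.fderiv_apply _).integrableOn_mul hu.memLp), hu.weak_grad φ hφ i]
    ring
  · rw [smul_zero, add_zero, one_mul]
    exact (closedBall_subset_cthickening hx t).trans ((cthickening_mono ht.2.le _).trans hδV)

theorem MemW12.integrableOn_sq_mul_test {V : Set (EuclideanSpace ℝ (Fin d))}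
    (hV : MeasurableSet V) {u : EuclideanSpace ℝ (Fin d) → ℝ}
    {Du : EuclideanSpace ℝ (Fin d) → EuclideanSpace ℝ (Fin d)} (hu : MemW12 V u Du)
    {ψ : EuclideanSpace ℝ (Fin d) → ℝ} (hψ : IsTestFunction V ψ) :
    IntegrableOn (fun x => u x ^ 2 * ψ x) V := by
  have h1 : MemLp (fun x => ψ x * u x) 2 := by simpa using (hu.test_mul hV hψ).memLp
  refine (hu.memLp.integrable_mul (h1.restrict V)).congr (ae_of_all _ fun x => ?_)
  simp only [Pi.mul_apply]; ring

theorem MemW12.integrableOn_inner_test {V U : Set (EuclideanSpace ℝ (Fin d))}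
    (hV : MeasurableSet V) {u : EuclideanSpace ℝ (Fin d) → ℝ} (hUV : U ⊆ V)
    {Du : EuclideanSpace ℝ (Fin d) → EuclideanSpace ℝ (Fin d)} (hu : MemW12 V u Du)
    {ψ : EuclideanSpace ℝ (Fin d) → ℝ} (hψ : IsTestFunction V ψ) :
    IntegrableOn (fun x => inner ℝ (Du x) (ψ x • Du x + u x • gradient ψ x)) U := by
  have h1 : MemLp (fun x => ψ x • Du x + u x • gradient ψ x) 2 := by
    simpa using (hu.test_mul hV hψ).memLp_grad
  have h2 : MemLp Du 2 (volume.restrict U) :=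
    hu.memLp_grad.mono_measure (Measure.restrict_mono hUV le_rfl)
  refine (L2.integrable_inner (𝕜 := ℝ) (h2.toLp Du) ((h1.restrict U).toLp _)).congr ?_
  filter_upwards [h2.coeFn_toLp, (h1.restrict U).coeFn_toLp] with x hx hx'
  rw [hx, hx']

section Subharmonic

variable {V U : Set (EuclideanSpace ℝ (Fin d))} {u : EuclideanSpace ℝ (Fin d) → ℝ}
  {Du : EuclideanSpace ℝ (Fin d) → EuclideanSpace ℝ (Fin d)}

/-- Near a point where `U` satisfies the cone condition, `ψ u` is an admissible test function in
the equation for `u` in `U`. -/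
theorem integral_inner_test_mul_eq_zero_of_cone (hV : IsOpen V) (hU : IsOpen U) (hUV : U ⊆ V)
    (hu : MemW12 V u Du) (hharm : IsWeaklyHarmonic U Du)
    (hzero : ∀ᵐ x, x ∈ V \ U → u x = 0) {ψ : EuclideanSpace ℝ (Fin d) → ℝ}
    (hψ : IsTestFunction V ψ) {x₀ : EuclideanSpace ℝ (Fin d)} {ρ : ℝ}
    {ν : EuclideanSpace ℝ (Fin d)} {δ t₀ : ℝ} (hδ : 0 < δ) (ht₀ : 0 < t₀)
    (hcone : ∀ x ∈ ball x₀ ρ ∩ U, ∀ t ∈ Ioo 0 t₀, closedBall (x + t • ν) (δ * t) ⊆ U)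
    (hψρ : tsupport ψ ⊆ ball x₀ ρ) :
    ∫ x in U, inner ℝ (Du x) (ψ x • Du x + u x • gradient ψ x) = 0 := by
  have hgrad : MemLp Du 2 (volume.restrict U) :=
    hu.memLp_grad.mono_measure (Measure.restrict_mono hUV le_rfl)
  have hind : ∀ g : EuclideanSpace ℝ (Fin d) → EuclideanSpace ℝ (Fin d),
      ∫ x, (0 * 0 + ∑ i, U.indicator (fun x => Du x i) x * g x i) =
        ∫ x in U, inner ℝ (Du x) (g x) := by
    intro g
    rw [← integral_indicator hU.measurableSet]
    refine integral_congr_ae (ae_of_all _ fun x => ?_)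
    by_cases hx : x ∈ U <;> simp [hx, inner_eq_sum_mul]
  have key := weak_identity_of_cone (U := U) (A₀ := 0)
    (A := fun i => U.indicator fun x => Du x i) MemLp.zero
    (fun i => (memLp_indicator_iff_restrict hU.measurableSet).2 (memLp_apply hgrad i))
    (fun φ hφ => ?_) (hu.test_mul hV.measurableSet hψ) (S := tsupport ψ ∩ U)
    (hψ.2.1.isCompact.isBounded.subset inter_subset_left) ?_ hδ ht₀
    (fun x hx => hcone x ⟨hψρ hx.1, hx.2⟩)
  · rw [← hind]
    simpa using key
  · have := hharm φ hφ
    rw [← hind] at this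
    simpa [gradient_apply_eq_fderiv] using this
  · filter_upwards [hzero] with x hx hxS
    by_cases hxψ : x ∈ tsupport ψ
    · rw [hx ⟨hψ.2.2 hxψ, fun hxU => hxS ⟨hxψ, hxU⟩⟩, mul_zero]
    · rw [image_eq_zero_of_notMem_tsupport hxψ, zero_mul]

open scoped Manifold in
/-- A finite smooth partition of unity on a compact set, subordinate to balls of prescribed radii
around points of that set. -/
theorem exists_partition_of_unity {K : Set (EuclideanSpace ℝ (Fin d))} (hK : IsCompact K)
    {r : EuclideanSpace ℝ (Fin d) → ℝ} (hr : ∀ x ∈ K, 0 < r x) :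
    ∃ (s : Finset (EuclideanSpace ℝ (Fin d)))
      (χ : s → EuclideanSpace ℝ (Fin d) → ℝ), (∀ i : s, (i : EuclideanSpace ℝ (Fin d)) ∈ K) ∧
      (∀ i, ContDiff ℝ ∞ (χ i)) ∧
      (∀ i, tsupport (χ i) ⊆ ball (i : EuclideanSpace ℝ (Fin d)) (r i)) ∧
      ∀ x ∈ K, ∑ i, χ i x = 1 := by
  obtain ⟨s, hsK, hs⟩ := hK.elim_nhds_subcover (fun x => ball x (r x))
    fun x hx => ball_mem_nhds x (hr x hx)
  obtain ⟨f, hf⟩ := SmoothPartitionOfUnity.exists_isSubordinate 𝓘(ℝ, EuclideanSpace ℝ (Fin d))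
    hK.isClosed (fun i : s => ball (i : EuclideanSpace ℝ (Fin d)) (r i)) (fun i => isOpen_ball)
    (by simpa [iUnion_subtype] using hs)
  refine ⟨s, fun i => f i, fun i => hsK i i.2, fun i => (f i).contMDiff.contDiff, hf,
    fun x hx => ?_⟩
  have := f.sum_eq_one hx
  rwa [finsum_eq_sum_of_fintype] at this

/-- For every test function `ψ`, the product `ψ u` is admissible in the equation for `u`. -/
theorem integral_inner_test_mul_eq_zero (hV : IsOpen V) (hU : IsOpen U) (hUV : U ⊆ V)
    (hcone : ∀ x ∈ V, UniformConeAt U x)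
    (hu : MemW12 V u Du) (hharm : IsWeaklyHarmonic U Du)
    (hzero : ∀ᵐ x, x ∈ V \ U → u x = 0) {ψ : EuclideanSpace ℝ (Fin d) → ℝ}
    (hψ : IsTestFunction V ψ) :
    ∫ x in U, inner ℝ (Du x) (ψ x • Du x + u x • gradient ψ x) = 0 := by
  choose! r hr ν δ hδ t₀ ht₀ hc using hcone
  obtain ⟨s, χ, hsK, hχ, hχr, hχ1⟩ := exists_partition_of_unity hψ.2.1.isCompact
    (fun x hx => hr x (hψ.2.2 hx))
  have htest : ∀ i, IsTestFunction V fun x => ψ x * χ i x := fun i => hψ.contDiff_mul (hχ i)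
  have hloc : ∀ i, ∫ x in U, inner ℝ (Du x) ((ψ x * χ i x) • Du x +
      u x • gradient (fun x => ψ x * χ i x) x) = 0 := by
    intro i
    have hiV : (i : EuclideanSpace ℝ (Fin d)) ∈ V := hψ.2.2 (hsK i)
    exact integral_inner_test_mul_eq_zero_of_cone hV hU hUV hu hharm hzero (htest i)
      (hδ _ hiV) (ht₀ _ hiV) (hc _ hiV) (tsupport_mul_subset_right.trans (hχr i))
  have hsum : ∀ x, ψ x = ∑ i, ψ x * χ i x := by
    intro x
    rw [← Finset.mul_sum]
    by_cases hx : x ∈ tsupport ψ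
    · rw [hχ1 x hx, mul_one]
    · rw [image_eq_zero_of_notMem_tsupport hx, zero_mul]
  have hgsum : ∀ x, gradient ψ x = ∑ i, gradient (fun x => ψ x * χ i x) x := by
    intro x
    ext j
    have h1 : ψ = fun x => ∑ i, ψ x * χ i x := funext hsum
    conv_lhs => rw [h1]
    simp only [gradient_apply_eq_fderiv, WithLp.ofLp_sum, Finset.sum_apply]
    rw [fderiv_fun_sum fun i _ => (htest i).differentiable.differentiableAt]
    simp
  have hsplit : ∀ x, inner ℝ (Du x) (ψ x • Du x + u x • gradient ψ x) =
      ∑ i, inner ℝ (Du x) ((ψ x * χ i x) • Du x +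
        u x • gradient (fun x => ψ x * χ i x) x) := by
    intro x
    rw [← inner_sum, Finset.sum_add_distrib, ← Finset.sum_smul, ← Finset.smul_sum, ← hsum,
      ← hgsum]
  simp only [hsplit]
  rw [integral_finsetSum _ fun i _ =>
    hu.integrableOn_inner_test hV.measurableSet hUV (htest i)]
  exact Finset.sum_eq_zero fun i _ => hloc i

/-- The square of `u` is weakly subharmonic in `V`, across the set `V \ U` on which `u` vanishes. -/
theorem integral_sq_mul_laplacian_nonneg (hV : IsOpen V) (hU : IsOpen U) (hUV : U ⊆ V)
    (hcone : ∀ x ∈ V, UniformConeAt U x)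
    (hu : MemW12 V u Du) (hharm : IsWeaklyHarmonic U Du)
    (hzero : ∀ᵐ x, x ∈ V \ U → u x = 0) {φ : EuclideanSpace ℝ (Fin d) → ℝ}
    (hφ : IsTestFunction V φ) (hφ0 : ∀ x, 0 ≤ φ x) :
    0 ≤ ∫ x in V, u x ^ 2 * ∑ i, fderiv ℝ (fun y => fderiv ℝ φ y (EuclideanSpace.single i 1)) x
      (EuclideanSpace.single i 1) := by
  have hφi := fun i : Fin d => hφ.fderiv_apply (EuclideanSpace.single i 1)
  have hint1 : ∀ i, IntegrableOn (fun x => u x * Du x i *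
      fderiv ℝ φ x (EuclideanSpace.single i 1)) V := by
    intro i
    have h1 : MemLp (fun x => fderiv ℝ φ x (EuclideanSpace.single i 1) * u x) 2 := by
      simpa using (hu.test_mul hV.measurableSet (hφi i)).memLp
    refine ((memLp_apply hu.memLp_grad i).integrable_mul (h1.restrict V)).congr
      (ae_of_all _ fun x => ?_)
    simp only [Pi.mul_apply]; ring
  have hint2 : ∀ i, IntegrableOn (fun x => u x ^ 2 *
      fderiv ℝ (fun y => fderiv ℝ φ y (EuclideanSpace.single i 1)) x
        (EuclideanSpace.single i 1)) V := by
    exact fun i => hu.integrableOn_sq_mul_test hV.measurableSet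
      ((hφi i).fderiv_apply (EuclideanSpace.single i 1))
  -- Sum of the integrations by parts over the coordinates.
  have hparts : ∫ x in V, u x ^ 2 *
      ∑ i, fderiv ℝ (fun y => fderiv ℝ φ y (EuclideanSpace.single i 1)) x
      (EuclideanSpace.single i 1) =
      -2 * ∫ x in V, u x * inner ℝ (Du x) (gradient φ x) := by
    have h1 : ∀ i, ∫ x in V, u x ^ 2 *
        fderiv ℝ (fun y => fderiv ℝ φ y (EuclideanSpace.single i 1)) x
        (EuclideanSpace.single i 1) =
        -2 * ∫ x in V, u x * Du x i * fderiv ℝ φ x (EuclideanSpace.single i 1) := by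
      intro i
      have := hu.integral_sq_mul_fderiv hV (hφi i) i
      rw [integral_add ((hint1 i).const_mul 2) (hint2 i), integral_const_mul] at this
      linarith
    simp only [Finset.mul_sum, inner_eq_sum_mul, gradient_apply_eq_fderiv, ← mul_assoc]
    rw [integral_finsetSum _ fun i _ => hint2 i, integral_finsetSum _ fun i _ => hint1 i,
      Finset.mul_sum]
    exact Finset.sum_congr rfl fun i _ => h1 i
  have hrestr : ∫ x in V, u x * inner ℝ (Du x) (gradient φ x) =
      ∫ x in U, u x * inner ℝ (Du x) (gradient φ x) := by
    refine (setIntegral_eq_of_subset_of_ae_sdiff_eq_zero hV.measurableSet.nullMeasurableSet hUV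
      ?_)
    filter_upwards [hzero] with x hx hxVU
    rw [hx hxVU, zero_mul]
  have hpos : 0 ≤ ∫ x in U, φ x * ‖Du x‖ ^ 2 := integral_nonneg fun x => by
    have := hφ0 x; positivity
  have htest := integral_inner_test_mul_eq_zero hV hU hUV hcone hu hharm hzero hφ
  have hsplit : ∀ x, inner ℝ (Du x) (φ x • Du x + u x • gradient φ x) =
      φ x * ‖Du x‖ ^ 2 + u x * inner ℝ (Du x) (gradient φ x) := by
    intro x
    rw [inner_add_right, inner_smul_right, inner_smul_right, real_inner_self_eq_norm_sq]
  have hint3 : IntegrableOn (fun x => u x * inner ℝ (Du x) (gradient φ x)) U := by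
    simp only [inner_eq_sum_mul, gradient_apply_eq_fderiv, Finset.mul_sum, ← mul_assoc]
    exact integrable_finsetSum _ fun i _ => (hint1 i).mono_set hUV
  have hint4 : IntegrableOn (fun x => φ x * ‖Du x‖ ^ 2) U := by
    refine ((hu.integrableOn_inner_test hV.measurableSet hUV hφ).sub hint3).congr
      (ae_of_all _ fun x => ?_)
    simp only [Pi.sub_apply, hsplit]; ring
  simp only [hsplit] at htest
  rw [integral_add hint4 hint3] at htest
  rw [hparts, hrestr]
  linarith

end Subharmonic

/-! ### The cone condition for the perforated space -/

namespace UniformConeAt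

variable {U U' : Set (EuclideanSpace ℝ (Fin d))} {x₀ : EuclideanSpace ℝ (Fin d)}

/-- The cone condition is local. -/
theorem congr (h : UniformConeAt U x₀) (hUU' : ∀ᶠ x in 𝓝 x₀, x ∈ U ↔ x ∈ U') :
    UniformConeAt U' x₀ := by
  obtain ⟨ρ, hρ, ν, δ, hδ, t₀, ht₀, hc⟩ := h
  obtain ⟨r, hr, hrU⟩ := Metric.eventually_nhds_iff.1 hUU'
  refine ⟨min ρ (r / 2), by positivity, ν, δ, hδ, min t₀ (r / (2 * (‖ν‖ + δ))),
    by positivity, ?_⟩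
  rintro x ⟨hx, hxU'⟩ t ⟨ht0, ht⟩ y hy
  have hxr : dist x x₀ < r / 2 := hx.trans_le (min_le_right _ _)
  have hxU : x ∈ U := (hrU (by linarith)).2 hxU'
  have hyU := hc x ⟨mem_ball.2 (hx.trans_le (min_le_left _ _)), hxU⟩ t ⟨ht0, ht.trans_le (min_le_left _ _)⟩ hy
  refine (hrU ?_).1 hyU
  have h1 : t * (‖ν‖ + δ) < r / 2 := by
    have := ht.trans_le (min_le_right _ _)
    rw [lt_div_iff₀ (by positivity)] at this
    linarith
  have h2 : dist (x + t • ν) x = t * ‖ν‖ := by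
    rw [dist_eq_norm, add_sub_cancel_left, norm_smul, Real.norm_eq_abs, abs_of_pos ht0]
  have h3 := dist_triangle4 y (x + t • ν) x x₀
  rw [mem_closedBall] at hy
  linarith

theorem of_isOpen (hU : IsOpen U) (hx : x₀ ∈ U) : UniformConeAt U x₀ := by
  have h : UniformConeAt univ x₀ := ⟨1, one_pos, 0, 1, one_pos, 1, one_pos, by simp⟩
  exact h.congr (by filter_upwards [hU.mem_nhds hx] with x hx; simp [hx])

/-- The cone condition is invariant under dilations and translations. -/
theorem smul_add {s : ℝ} (hs : 0 < s) (a : EuclideanSpace ℝ (Fin d))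
    (h : UniformConeAt U (s⁻¹ • (x₀ - a))) :
    UniformConeAt ((fun x => s⁻¹ • (x - a)) ⁻¹' U) x₀ := by
  obtain ⟨ρ, hρ, ν, δ, hδ, t₀, ht₀, hc⟩ := h
  have hdist : ∀ x y : EuclideanSpace ℝ (Fin d),
      dist (s⁻¹ • (x - a)) (s⁻¹ • (y - a)) = s⁻¹ * dist x y := by
    intro x y
    rw [dist_smul₀, dist_sub_right, Real.norm_eq_abs, abs_of_pos (by positivity)]
  refine ⟨s * ρ, by positivity, ν, δ, hδ, s * t₀, by positivity, ?_⟩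
  rintro x ⟨hx, hxU⟩ t ⟨ht0, ht⟩ y hy
  refine hc (s⁻¹ • (x - a)) ⟨?_, hxU⟩ (s⁻¹ * t) ⟨by positivity, ?_⟩ ?_
  · rw [mem_ball, hdist, inv_mul_lt_iff₀ hs]
    exact hx
  · rwa [inv_mul_lt_iff₀ hs]
  · have h1 : s⁻¹ • (x - a) + (s⁻¹ * t) • ν = s⁻¹ • ((x + t • ν) - a) := by
      rw [add_sub_right_comm, _root_.smul_add, smul_smul]
    rw [mem_closedBall, h1, hdist, mul_left_comm]
    exact mul_le_mul_of_nonneg_left hy (by positivity)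

end UniformConeAt

/-- The complement of the closure of a set with Lipschitz boundary satisfies the cone condition
at every boundary point: the points outside lie below a Lipschitz graph and are pushed
downwards. -/
theorem HasLipschitzBoundary.uniformConeAt {D : Set (EuclideanSpace ℝ (Fin d))}
    (hD : HasLipschitzBoundary D) {x₀ : EuclideanSpace ℝ (Fin d)} (hx₀ : x₀ ∈ frontier D) :
    UniformConeAt (closure D)ᶜ x₀ := by
  obtain ⟨ρ, hρ, ν, hν, K, ψ, hψ, hDψ⟩ := hD x₀ hx₀
  have hK := K.coe_nonneg
  refine ⟨ρ / 2, by positivity, -ν, 1 / (2 * (1 + K)), by positivity, ρ / 4, by positivity, ?_⟩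
  set δ : ℝ := 1 / (2 * (1 + K)) with hδdef
  have hδ : 0 < δ := by positivity
  -- The cone is narrow enough that the drop `t` beats both the opening and the slope of `ψ`.
  have hδK : δ + K * δ = 1 / 2 := by rw [hδdef]; field_simp
  rintro x ⟨hx, hxD⟩ t ⟨ht0, ht⟩ y hy
  rw [mem_ball] at hx
  rw [mem_closedBall, dist_eq_norm] at hy
  set v := y - (x + t • -ν) with hv
  have hyv : y = x - t • ν + v := by rw [hv]; module
  have hx' : x ∈ ball x₀ ρ := by rw [mem_ball]; linarith
  have hδ1 : δ ≤ 1 / 2 := by nlinarith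
  have hy' : y ∈ ball x₀ ρ := by
    rw [mem_ball]
    have h1 : dist y x ≤ t + δ * t := by
      rw [dist_eq_norm, hyv, show x - t • ν + v - x = v - t • ν by abel]
      calc ‖v - t • ν‖ ≤ ‖v‖ + ‖t • ν‖ := norm_sub_le _ _
        _ ≤ δ * t + t := by
          rw [norm_smul, hν, mul_one, Real.norm_eq_abs, abs_of_pos ht0]; gcongr
        _ = _ := by ring
    have h2 := dist_triangle y x x₀
    nlinarith
  have hxψ : inner ℝ ν x ≤ ψ (x - (inner ℝ ν x) • ν) := by
    by_contra! hlt
    exact hxD (subset_closure ((hDψ x hx').2 hlt))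
  have hνν : inner ℝ ν ν = 1 := by rw [real_inner_self_eq_norm_sq, hν, one_pow]
  have hνv : inner ℝ ν v ≤ δ * t := by
    have := real_inner_le_norm ν v
    rw [hν, one_mul] at this
    exact this.trans hy
  have hproj : ‖v - (inner ℝ ν v) • ν‖ ≤ ‖v‖ := by
    refine le_of_sq_le_sq ?_ (norm_nonneg _)
    rw [@norm_sub_sq_real, norm_smul, hν, inner_smul_right, real_inner_comm, mul_one,
      Real.norm_eq_abs, sq_abs]
    nlinarith [sq_nonneg (inner ℝ ν v)]
  have hin : inner ℝ ν y = inner ℝ ν x - t + inner ℝ ν v := by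
    rw [hyv, inner_add_right, inner_sub_right, inner_smul_right, hνν, mul_one]
  -- Orthogonal projection along `ν` does not see the shift by `t ν`.
  have hdiff : (x - (inner ℝ ν x) • ν) - (y - (inner ℝ ν y) • ν) =
      -(v - (inner ℝ ν v) • ν) := by
    rw [hin, hyv]
    module
  have hlip := hψ.dist_le_mul (x - (inner ℝ ν x) • ν) (y - (inner ℝ ν y) • ν)
  rw [Real.dist_eq, dist_eq_norm, hdiff, norm_neg] at hlip
  have hlip' := (le_abs_self _).trans (hlip.trans
    (mul_le_mul_of_nonneg_left (hproj.trans hy) hK))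
  have hyψ : inner ℝ ν y < ψ (y - (inner ℝ ν y) • ν) := by nlinarith
  have hopen : ∀ᶠ z in 𝓝 y, inner ℝ ν z < ψ (z - (inner ℝ ν z) • ν) :=
    ContinuousAt.eventually_lt (by fun_prop) (hψ.continuous.continuousAt.comp (by fun_prop)) hyψ
  intro hyD
  obtain ⟨z, ⟨hz1, hz2⟩, hzD⟩ :=
    mem_closure_iff_nhds.1 hyD _ (inter_mem hopen (isOpen_ball.mem_nhds hy'))
  exact lt_asymm hz1 ((hDψ z hz2).1 hzD)

theorem isClosed_unitCell : IsClosed (unitCell d) := by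
  have h : unitCell d = ⋂ i, (fun x : EuclideanSpace ℝ (Fin d) => x i) ⁻¹'
      Icc (-(1 / 2)) (1 / 2) := by
    ext x; simp [unitCell]
  rw [h]
  exact isClosed_iInter fun i => isClosed_Icc.preimage (by fun_prop)

theorem abs_apply_lt_of_mem_interior_unitCell {x : EuclideanSpace ℝ (Fin d)}
    (hx : x ∈ interior (unitCell d)) (i : Fin d) : |x i| < 1 / 2 := by
  have hsurj : Function.Surjective
      (EuclideanSpace.proj i : EuclideanSpace ℝ (Fin d) →L[ℝ] ℝ) := fun c =>
    ⟨EuclideanSpace.single i c, by simp⟩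
  have hopen := ContinuousLinearMap.isOpenMap _ hsurj _ (isOpen_interior (s := unitCell d))
  have hsub : (EuclideanSpace.proj i : EuclideanSpace ℝ (Fin d) →L[ℝ] ℝ) ''
      interior (unitCell d) ⊆ Icc (-(1 / 2)) (1 / 2) := by
    rintro _ ⟨y, hy, rfl⟩
    exact interior_subset hy i
  have h := interior_maximal hsub hopen (mem_image_of_mem _ hx)
  rw [interior_Icc] at h
  exact abs_lt.2 h

namespace IsHole

variable {c₀ : ℝ} {T : Set (EuclideanSpace ℝ (Fin d))}

theorem isClosed (hT : IsHole c₀ T) : IsClosed T := by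
  obtain ⟨D, -, -, -, rfl⟩ := hT.eq_closure
  exact isClosed_closure

theorem subset_unitCell (hT : IsHole c₀ T) : T ⊆ unitCell d := by
  obtain ⟨D, -, hD, -, rfl⟩ := hT.eq_closure
  exact closure_minimal hD isClosed_unitCell

/-- The hole lies in the interior of the cell: a point of `T` on `∂Y` would lie on `∂T` as well. -/
theorem abs_apply_lt (hc₀ : 0 < c₀) (hT : IsHole c₀ T) {x : EuclideanSpace ℝ (Fin d)}
    (hx : x ∈ T) (i : Fin d) : |x i| < 1 / 2 := by
  refine abs_apply_lt_of_mem_interior_unitCell ?_ i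
  by_contra hxi
  have hxT : x ∈ frontier T :=
    ⟨subset_closure hx, fun h => hxi (interior_mono hT.subset_unitCell h)⟩
  have hxY : x ∈ frontier (unitCell d) := ⟨subset_closure (hT.subset_unitCell hx), hxi⟩
  have := hT.dist_le x hxT x hxY
  rw [dist_self] at this
  exact absurd hc₀ this.not_gt

/-- At interior points of `T` the condition holds vacuously. -/
theorem uniformConeAt_compl (hT : IsHole c₀ T) (x : EuclideanSpace ℝ (Fin d)) :
    UniformConeAt Tᶜ x := by
  by_cases hx : x ∈ T
  · by_cases hxi : x ∈ interior T
    · have h : UniformConeAt ∅ x := ⟨1, one_pos, 0, 1, one_pos, 1, one_pos, by simp⟩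
      refine h.congr ?_
      filter_upwards [isOpen_interior.mem_nhds hxi] with y hy
      simp [interior_subset hy]
    · have hfr : x ∈ frontier T := ⟨subset_closure hx, hxi⟩
      obtain ⟨D, -, -, hD, rfl⟩ := hT.eq_closure
      exact hD.uniformConeAt (frontier_closure_subset hfr)
  · exact UniformConeAt.of_isOpen hT.isClosed.isOpen_compl hx

end IsHole

section Holes

variable {c₀ ε η : ℝ} {T : Set (EuclideanSpace ℝ (Fin d))}

theorem image_hole_eq_preimage (hε : 0 < ε) (hη : 0 < η) (k : Fin d → ℤ) :
    (fun y => ε • (latticePoint k + η • y)) '' T =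
      (fun x => (ε * η)⁻¹ • (x - ε • latticePoint k)) ⁻¹' T := by
  refine congrFun (image_eq_preimage_of_inverse (fun y => ?_) (fun x => ?_)) T
  · simp only [smul_add, add_sub_cancel_left, smul_smul]
    rw [inv_mul_cancel₀ (by positivity), one_smul]
  · have h : ε * η * (ε * η)⁻¹ = 1 := mul_inv_cancel₀ (by positivity)
    simp only [smul_add, smul_smul]
    rw [← mul_assoc, h, one_smul, add_sub_cancel]

/-- The hole with index `k` lies in the open cell of side `ε` centred at `ε k`. -/
theorem abs_apply_sub_lt_of_mem_image_hole (hc₀ : 0 < c₀) (hT : IsHole c₀ T) (hε : 0 < ε)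
    (hη : 0 < η) (hη1 : η ≤ 1) {k : Fin d → ℤ} {x : EuclideanSpace ℝ (Fin d)}
    (hx : x ∈ (fun y => ε • (latticePoint k + η • y)) '' T) (i : Fin d) :
    |x i - ε * k i| < ε / 2 := by
  obtain ⟨y, hy, rfl⟩ := hx
  have h1 := hT.abs_apply_lt hc₀ hy i
  have h2 : (ε • (latticePoint k + η • y)) i - ε * k i = ε * (η * y i) := by
    simp [latticePoint]
  rw [h2, abs_mul, abs_mul, abs_of_pos hε, abs_of_pos hη]
  have h3 : η * |y i| < 1 / 2 := by nlinarith [abs_nonneg (y i)]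
  nlinarith

theorem locallyFinite_image_hole (hc₀ : 0 < c₀) (hT : IsHole c₀ T) (hε : 0 < ε)
    (hη : 0 < η) (hη1 : η ≤ 1) :
    LocallyFinite fun k : Fin d → ℤ => (fun y => ε • (latticePoint k + η • y)) '' T := by
  intro x
  refine ⟨ball x 1, ball_mem_nhds x one_pos, (finite_Icc
    (fun i => ⌊(x i - 1 - ε / 2) / ε⌋) (fun i => ⌈(x i + 1 + ε / 2) / ε⌉)).subset ?_⟩
  rintro k ⟨z, hzk, hzx⟩
  have h : ∀ i, x i - 1 - ε / 2 < ε * k i ∧ ε * k i < x i + 1 + ε / 2 := by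
    intro i
    have h1 := abs_lt.1 (abs_apply_sub_lt_of_mem_image_hole hc₀ hT hε hη hη1 hzk i)
    have h2 : |z i - x i| < 1 := by
      have := PiLp.norm_apply_le (z - x) i
      rw [← dist_eq_norm] at this
      exact this.trans_lt hzx
    have h3 := abs_lt.1 h2
    constructor <;> linarith [h1.1, h1.2, h3.1, h3.2]
  refine ⟨fun i => ?_, fun i => ?_⟩
  · have h1 : (x i - 1 - ε / 2) / ε < k i := by rw [div_lt_iff₀ hε]; linarith [(h i).1]
    exact Int.cast_le.1 ((Int.floor_le _).trans h1.le)
  · have h1 : (k i : ℝ) < (x i + 1 + ε / 2) / ε := by rw [lt_div_iff₀ hε]; linarith [(h i).2]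
    exact Int.cast_le.1 (h1.le.trans (Int.le_ceil _))

theorem isOpen_perforated (hc₀ : 0 < c₀) (hT : IsHole c₀ T) (hε : 0 < ε)
    (hη : 0 < η) (hη1 : η ≤ 1) : IsOpen (perforated T ε η) := by
  refine ((locallyFinite_image_hole hc₀ hT hε hη hη1).isClosed_iUnion fun k => ?_).isOpen_compl
  rw [image_hole_eq_preimage hε hη]
  exact hT.isClosed.preimage (by fun_prop)

theorem uniformConeAt_perforated (hc₀ : 0 < c₀) (hT : IsHole c₀ T) (hε : 0 < ε)
    (hη : 0 < η) (hη1 : η ≤ 1) (x : EuclideanSpace ℝ (Fin d)) :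
    UniformConeAt (perforated T ε η) x := by
  by_cases hx : x ∈ perforated T ε η
  · exact UniformConeAt.of_isOpen (isOpen_perforated hc₀ hT hε hη hη1) hx
  obtain ⟨k, hk⟩ := mem_iUnion.1 (not_not.1 hx)
  have hcone := (hT.uniformConeAt_compl ((ε * η)⁻¹ • (x - ε • latticePoint k))).smul_add
    (by positivity) (ε • latticePoint k)
  refine hcone.congr ?_
  -- The cell around the hole with index `k` meets no other hole.
  have hcell : ∀ᶠ z in 𝓝 x, ∀ i, |z i - ε * k i| < ε / 2 := by
    rw [eventually_all]
    intro i
    exact ContinuousAt.eventually_lt (by fun_prop) continuousAt_const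
      (abs_apply_sub_lt_of_mem_image_hole hc₀ hT hε hη hη1 hk i)
  filter_upwards [hcell] with z hz
  rw [preimage_compl, ← image_hole_eq_preimage hε hη, perforated, mem_compl_iff, mem_compl_iff,
    not_iff_not, mem_iUnion]
  refine ⟨fun h => ⟨k, h⟩, ?_⟩
  rintro ⟨j, hj⟩
  have hjk : j = k := by
    funext i
    have h1 := abs_lt.1 (abs_apply_sub_lt_of_mem_image_hole hc₀ hT hε hη hη1 hj i)
    have h2 := abs_lt.1 (hz i)
    have h3 : ε * (j i - k i : ℝ) < ε * 1 := by linarith [h1.1, h2.2]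
    have h4 : ε * (k i - j i : ℝ) < ε * 1 := by linarith [h1.2, h2.1]
    have h5 : (j i - k i : ℝ) < 1 := lt_of_mul_lt_mul_left h3 hε.le
    have h6 : (k i - j i : ℝ) < 1 := lt_of_mul_lt_mul_left h4 hε.le
    have h7 : j i - k i < 1 := by exact_mod_cast h5
    have h8 : k i - j i < 1 := by exact_mod_cast h6
    omega
  exact hjk ▸ hj

end Holes

/-! ### A radial test function -/

theorem fderiv_radial {f g : ℝ → ℝ} (hf : ∀ z, HasDerivAt f (-g z) z)
    (x v : EuclideanSpace ℝ (Fin d)) :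
    fderiv ℝ (fun x : EuclideanSpace ℝ (Fin d) => f (‖x‖ ^ 2)) x v =
      -2 * (g (‖x‖ ^ 2) * inner ℝ x v) := by
  have h := (hf (‖x‖ ^ 2)).comp_hasFDerivAt x (hasStrictFDerivAt_norm_sq x).hasFDerivAt
  have h2 : fderiv ℝ (fun x : EuclideanSpace ℝ (Fin d) => f (‖x‖ ^ 2)) x = _ := h.fderiv
  rw [h2]
  simp
  ring

/-- The Laplacian of `x ↦ f (|x|²)` in terms of `g = -f'`. -/
theorem laplacian_radial {f g g' : ℝ → ℝ} (hf : ∀ z, HasDerivAt f (-g z) z)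
    (hg : ∀ z, HasDerivAt g (g' z) z) (x : EuclideanSpace ℝ (Fin d)) :
    ∑ i, fderiv ℝ (fun y => fderiv ℝ (fun x : EuclideanSpace ℝ (Fin d) => f (‖x‖ ^ 2)) y
      (EuclideanSpace.single i 1)) x (EuclideanSpace.single i 1) =
      -2 * d * g (‖x‖ ^ 2) - 4 * ‖x‖ ^ 2 * g' (‖x‖ ^ 2) := by
  have h : ∀ i, fderiv ℝ (fun y => fderiv ℝ (fun x : EuclideanSpace ℝ (Fin d) => f (‖x‖ ^ 2)) y
      (EuclideanSpace.single i 1)) x (EuclideanSpace.single i 1) =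
      -2 * g (‖x‖ ^ 2) - 4 * x i ^ 2 * g' (‖x‖ ^ 2) := by
    intro i
    simp only [fderiv_radial hf]
    have h1 := (hg (‖x‖ ^ 2)).comp_hasFDerivAt x (hasStrictFDerivAt_norm_sq x).hasFDerivAt
    have h2 : HasFDerivAt (fun y : EuclideanSpace ℝ (Fin d) =>
        inner ℝ y (EuclideanSpace.single i (1 : ℝ)))
        (innerSL ℝ (EuclideanSpace.single i (1 : ℝ))) x := by
      simp_rw [fun y : EuclideanSpace ℝ (Fin d) =>
        real_inner_comm (EuclideanSpace.single i (1 : ℝ)) y]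
      exact (innerSL ℝ (EuclideanSpace.single i (1 : ℝ))).hasFDerivAt
    have h3 := ((h1.mul h2).const_mul (-2)).fderiv
    have h4 : fderiv ℝ (fun y : EuclideanSpace ℝ (Fin d) => -2 * (g (‖y‖ ^ 2) *
      inner ℝ y (EuclideanSpace.single i (1 : ℝ)))) x = _ := h3
    rw [h4]
    simp [EuclideanSpace.inner_single_right]
    ring
  rw [Finset.sum_congr rfl fun i _ => h i, Finset.sum_sub_distrib, Finset.sum_const,
    ← Finset.sum_mul, ← Finset.mul_sum, ← EuclideanSpace.real_norm_sq_eq, Finset.card_univ,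
    Fintype.card_fin, nsmul_eq_mul]
  ring

theorem deriv_smoothTransition_eq_zero {x : ℝ} (hx : x ≤ 0 ∨ 1 ≤ x) :
    deriv Real.smoothTransition x = 0 := by
  -- The function attains its minimum or its maximum at `x`.
  rcases hx with hx | hx
  · refine IsLocalMin.deriv_eq_zero (Eventually.of_forall fun y => ?_)
    rw [Real.smoothTransition.zero_of_nonpos hx]
    exact Real.smoothTransition.nonneg y
  · refine IsLocalMax.deriv_eq_zero (Eventually.of_forall fun y => ?_)
    rw [Real.smoothTransition.one_of_one_le hx]
    exact Real.smoothTransition.le_one y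

theorem exists_abs_deriv_smoothTransition_le :
    ∃ M > 0, ∀ x, |deriv Real.smoothTransition x| ≤ M := by
  have hcd : ContDiff ℝ 1 Real.smoothTransition := Real.smoothTransition.contDiff
  have hs : HasCompactSupport (deriv Real.smoothTransition) := by
    refine HasCompactSupport.intro (isCompact_Icc (a := (0 : ℝ)) (b := 1)) fun x hx => ?_
    rw [mem_Icc, not_and_or, not_le, not_le] at hx
    exact deriv_smoothTransition_eq_zero (hx.imp le_of_lt le_of_lt)
  obtain ⟨M, hM⟩ := hs.exists_bound_of_continuous (hcd.continuous_deriv (by simp))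
  exact ⟨max M 1, by positivity, fun x => (hM x).trans (le_max_left _ _)⟩

theorem pow_four_rpow {r : ℝ} (hr : 0 ≤ r) (d : ℕ) : (r ^ 4) ^ (-(d / 4) : ℝ) = (r ^ d)⁻¹ := by
  rw [← Real.rpow_natCast r 4, ← Real.rpow_mul hr, ← Real.rpow_natCast r d, ← Real.rpow_neg hr]
  congr 1
  push_cast
  ring

theorem isTestFunction_radial {f : ℝ → ℝ} (hf : ContDiff ℝ ∞ f) {R : ℝ} (hR : 0 < R)
    (hfz : ∀ z, R ^ 2 / 8 ≤ z → f z = 0) :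
    IsTestFunction (cube d R) fun x => f (‖x‖ ^ 2) := by
  have hsub : tsupport (fun x : EuclideanSpace ℝ (Fin d) => f (‖x‖ ^ 2)) ⊆
      {x | ‖x‖ ^ 2 ≤ R ^ 2 / 8} := by
    refine closure_minimal (fun x hx => ?_) (isClosed_le (by fun_prop) continuous_const)
    by_contra hx'
    exact hx (hfz _ (not_le.1 hx').le)
  refine ⟨hf.comp (contDiff_norm_sq ℝ), ?_, ?_⟩
  · refine (isCompact_closedBall (0 : EuclideanSpace ℝ (Fin d)) R).of_isClosed_subset
      (isClosed_tsupport _) fun x hx => ?_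
    rw [mem_closedBall_zero_iff]
    have : ‖x‖ ^ 2 ≤ R ^ 2 / 8 := hsub hx
    nlinarith [norm_nonneg x]
  · intro x hx i
    have h1 : ‖x‖ ^ 2 ≤ R ^ 2 / 8 := hsub hx
    have h2 : |x i| ≤ ‖x‖ := PiLp.norm_apply_le x i
    have h3 : |x i| < R / 2 := by nlinarith [abs_nonneg (x i)]
    exact abs_lt.1 h3

/-- A nonnegative test function in `Q_R` whose Laplacian is of order `-r^{-d}` on the small cube
`Q_r` and at most of order `R^{-d}` elsewhere. It is `f (|x|²)` with
`-f' (z) = (r⁴ + z²)^{-d/4}`, cut off for `z` of order `R²`: this is a regularization at scale `r`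
of the fundamental solution of the Laplacian. -/
theorem exists_testFunction_laplacian (d : ℕ) (hd : 1 ≤ d) :
    ∃ c > 0, ∃ C > 0, ∀ r R : ℝ, 0 < r → 2 * d * r ≤ R →
      ∃ φ : EuclideanSpace ℝ (Fin d) → ℝ, IsTestFunction (cube d R) φ ∧ (∀ x, 0 ≤ φ x) ∧
        (∀ x, ∑ i, fderiv ℝ (fun y => fderiv ℝ φ y (EuclideanSpace.single i 1)) x
          (EuclideanSpace.single i 1) ≤ C * (R ^ d)⁻¹) ∧
        ∀ x ∈ cube d r, ∑ i, fderiv ℝ (fun y => fderiv ℝ φ y (EuclideanSpace.single i 1)) x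
          (EuclideanSpace.single i 1) ≤ -(c * (r ^ d)⁻¹) := by
  obtain ⟨M, hM, hMle⟩ := exists_abs_deriv_smoothTransition_le
  have hd' : (1 : ℝ) ≤ d := by exact_mod_cast hd
  have hd0 : (0 : ℝ) < d := by linarith
  refine ⟨2 * d * (1 + d ^ 2 / 16) ^ (-(d / 4) - 1 : ℝ), by positivity,
    8 * M * 4 ^ d, by positivity, fun r R hr hrR => ?_⟩
  have hR : 0 < R := lt_of_lt_of_le (by positivity) hrR
  set B : ℝ → ℝ := fun z => r ^ 4 + z ^ 2 with hBdef
  have hB : ∀ z, 0 < B z := fun z => by positivity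
  set χ : ℝ → ℝ := fun z => Real.smoothTransition (2 - 16 / R ^ 2 * z) with hχdef
  set g : ℝ → ℝ := fun z => B z ^ (-(d / 4) : ℝ) * χ z with hgdef
  set g' : ℝ → ℝ := fun z => 2 * z * (-(d / 4) : ℝ) * B z ^ (-(d / 4) - 1 : ℝ) * χ z +
    B z ^ (-(d / 4) : ℝ) *
      (deriv Real.smoothTransition (2 - 16 / R ^ 2 * z) * -(16 / R ^ 2)) with hg'def
  have harg1 : ∀ z, z ≤ R ^ 2 / 16 → 1 ≤ 2 - 16 / R ^ 2 * z := by
    intro z hz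
    have : 16 / R ^ 2 * z ≤ 16 / R ^ 2 * (R ^ 2 / 16) := by gcongr
    have h2 : 16 / R ^ 2 * (R ^ 2 / 16) = 1 := by field_simp
    linarith
  have harg0 : ∀ z, R ^ 2 / 8 ≤ z → 2 - 16 / R ^ 2 * z ≤ 0 := by
    intro z hz
    have : 16 / R ^ 2 * (R ^ 2 / 8) ≤ 16 / R ^ 2 * z := by gcongr
    have h2 : 16 / R ^ 2 * (R ^ 2 / 8) = 2 := by field_simp; norm_num
    linarith
  have hχ1 : ∀ z, z ≤ R ^ 2 / 16 → χ z = 1 := fun z hz =>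
    Real.smoothTransition.one_of_one_le (harg1 z hz)
  have hχ0 : ∀ z, R ^ 2 / 8 ≤ z → χ z = 0 := fun z hz =>
    Real.smoothTransition.zero_of_nonpos (harg0 z hz)
  have hχnn : ∀ z, 0 ≤ χ z := fun z => Real.smoothTransition.nonneg _
  have hBs : ContDiff ℝ ∞ B := by fun_prop
  have hgs : ContDiff ℝ ∞ g := by
    refine ContDiff.mul (hBs.rpow_const_of_ne fun z => (hB z).ne') ?_
    exact Real.smoothTransition.contDiff.comp (by fun_prop)
  have hg : ∀ z, HasDerivAt g (g' z) z := by
    intro z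
    have h1 : HasDerivAt B (2 * z) z := by
      simpa [hBdef] using (hasDerivAt_pow 2 z).const_add (r ^ 4)
    have h2 : HasDerivAt χ (deriv Real.smoothTransition (2 - 16 / R ^ 2 * z) * -(16 / R ^ 2)) z := by
      have h3 : HasDerivAt (fun z => 2 - 16 / R ^ 2 * z) (-(16 / R ^ 2)) z := by
        simpa using ((hasDerivAt_id z).const_mul (16 / R ^ 2)).const_sub 2
      exact ((Real.smoothTransition.contDiff (n := 1)).differentiable (by simp)
        _).hasDerivAt.comp z h3
    exact (h1.rpow_const (Or.inl (hB z).ne')).mul h2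
  set f : ℝ → ℝ := fun z => ∫ s in z..R ^ 2 / 8, g s with hfdef
  have hf : ∀ z, HasDerivAt f (-g z) z := fun z =>
    intervalIntegral.integral_hasDerivAt_left (hgs.continuous.intervalIntegrable _ _)
      (hgs.continuous.stronglyMeasurableAtFilter _ _) hgs.continuous.continuousAt
  have hfs : ContDiff ℝ ∞ f := by
    rw [contDiff_infty_iff_deriv]
    refine ⟨fun z => (hf z).differentiableAt, ?_⟩
    rw [show deriv f = fun z => -g z from funext fun z => (hf z).deriv]
    exact hgs.neg
  have hf0 : ∀ z, R ^ 2 / 8 ≤ z → f z = 0 := by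
    intro z hz
    refine (intervalIntegral.integral_congr (g := fun _ => 0) fun s hs => ?_).trans (by simp)
    rw [uIcc_of_ge hz] at hs
    simp [hgdef, hχ0 s hs.1]
  have hfnn : ∀ z, 0 ≤ f z := by
    intro z
    rcases le_total (R ^ 2 / 8) z with hz | hz
    · exact (hf0 z hz).ge
    · exact intervalIntegral.integral_nonneg hz fun s _ =>
        mul_nonneg (Real.rpow_nonneg (hB s).le _) (hχnn s)
  -- The cancellation behind the choice of `g`: away from the cutoff only a term in `r⁴` is left.
  have hlap : ∀ z, -2 * d * g z - 4 * z * g' z =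
      -(2 * d * r ^ 4 * B z ^ (-(d / 4) - 1 : ℝ) * χ z) +
        64 * (z / R ^ 2) * deriv Real.smoothTransition (2 - 16 / R ^ 2 * z) *
          B z ^ (-(d / 4) : ℝ) := by
    intro z
    have h1 : B z ^ (-(d / 4) : ℝ) = B z ^ (-(d / 4) - 1 : ℝ) * (r ^ 4 + z ^ 2) := by
      rw [Real.rpow_sub_one (hB z).ne', div_mul_cancel₀ _ (hB z).ne']
    simp only [hgdef, hg'def]
    rw [h1]
    field_simp
    ring
  refine ⟨fun x => f (‖x‖ ^ 2), isTestFunction_radial hfs hR hf0, fun x => hfnn _, ?_, ?_⟩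
  · intro x
    rw [laplacian_radial hf hg, hlap]
    set z := ‖x‖ ^ 2 with hz
    have hz0 : 0 ≤ z := by positivity
    have h1 : 0 ≤ 2 * d * r ^ 4 * B z ^ (-(d / 4) - 1 : ℝ) * χ z := by
      have := Real.rpow_nonneg (hB z).le (-(d / 4) - 1 : ℝ)
      have := hχnn z
      positivity
    suffices h2 : 64 * (z / R ^ 2) * deriv Real.smoothTransition (2 - 16 / R ^ 2 * z) *
        B z ^ (-(d / 4) : ℝ) ≤ 8 * M * 4 ^ d * (R ^ d)⁻¹ by linarith
    by_cases hzs : z ≤ R ^ 2 / 16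
    · rw [deriv_smoothTransition_eq_zero (Or.inr (harg1 z hzs)), mul_zero, zero_mul]
      positivity
    by_cases hzl : R ^ 2 / 8 ≤ z
    · rw [deriv_smoothTransition_eq_zero (Or.inl (harg0 z hzl)), mul_zero, zero_mul]
      positivity
    rw [not_le] at hzs hzl
    have hzR : z / R ^ 2 ≤ 1 / 8 := by rw [div_le_iff₀ (by positivity)]; linarith
    have hBz : B z ^ (-(d / 4) : ℝ) ≤ 4 ^ d * (R ^ d)⁻¹ := by
      have h3 : (R / 4) ^ 4 ≤ B z := by
        have h5 : (R ^ 2 / 16) ^ 2 ≤ z ^ 2 := by gcongr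
        have h6 : 0 ≤ r ^ 4 := by positivity
        have h7 : (R / 4) ^ 4 = (R ^ 2 / 16) ^ 2 := by ring
        rw [h7]
        exact h5.trans (by simp [hBdef, h6])
      calc B z ^ (-(d / 4) : ℝ) ≤ ((R / 4) ^ 4) ^ (-(d / 4) : ℝ) :=
            Real.rpow_le_rpow_of_nonpos (by positivity) h3 (by
              have : (0 : ℝ) ≤ d / 4 := by positivity
              linarith)
        _ = 4 ^ d * (R ^ d)⁻¹ := by
          rw [pow_four_rpow (by positivity), div_pow, inv_div, div_eq_mul_inv]
    calc 64 * (z / R ^ 2) * deriv Real.smoothTransition (2 - 16 / R ^ 2 * z) *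
          B z ^ (-(d / 4) : ℝ)
        ≤ 64 * (z / R ^ 2) * M * B z ^ (-(d / 4) : ℝ) := by
          have := Real.rpow_nonneg (hB z).le (-(d / 4) : ℝ)
          gcongr
          exact (le_abs_self _).trans (hMle _)
      _ ≤ 64 * (1 / 8) * M * (4 ^ d * (R ^ d)⁻¹) := by
          have := Real.rpow_nonneg (hB z).le (-(d / 4) : ℝ)
          gcongr
      _ = _ := by ring
  · intro x hx
    rw [laplacian_radial hf hg, hlap]
    set z := ‖x‖ ^ 2 with hz
    have hz0 : 0 ≤ z := by positivity
    have hzr : z ≤ d / 4 * r ^ 2 := by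
      rw [hz, EuclideanSpace.norm_sq_eq]
      calc ∑ i, ‖x i‖ ^ 2 ≤ ∑ _i : Fin d, (r / 2) ^ 2 := by
            gcongr with i
            exact (abs_lt.2 (hx i)).le
        _ = d / 4 * r ^ 2 := by simp; ring
    have hzR : z ≤ R ^ 2 / 16 := by
      have h1 : (2 * d * r) ^ 2 ≤ R ^ 2 := by gcongr
      nlinarith [sq_nonneg r, mul_nonneg hd0.le (sq_nonneg r)]
    rw [deriv_smoothTransition_eq_zero (Or.inr (harg1 z hzR)), hχ1 z hzR, mul_zero, zero_mul,
      add_zero, mul_one, neg_le_neg_iff]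
    have hBz : B z ≤ r ^ 4 * (1 + d ^ 2 / 16) := by
      have : z ^ 2 ≤ (d / 4 * r ^ 2) ^ 2 := by gcongr
      simp only [hBdef]
      nlinarith
    have h1 : (r ^ 4 * (1 + d ^ 2 / 16)) ^ (-(d / 4) - 1 : ℝ) ≤ B z ^ (-(d / 4) - 1 : ℝ) :=
      Real.rpow_le_rpow_of_nonpos (hB z) hBz (by
        have : (0 : ℝ) ≤ d / 4 := by positivity
        linarith)
    have h2 : (r ^ 4 * (1 + (d : ℝ) ^ 2 / 16)) ^ (-(d / 4) - 1 : ℝ) =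
        (r ^ d)⁻¹ / r ^ 4 * (1 + d ^ 2 / 16) ^ (-(d / 4) - 1 : ℝ) := by
      rw [Real.mul_rpow (by positivity) (by positivity), Real.rpow_sub_one (x := r ^ 4) (by positivity),
        pow_four_rpow hr.le]
    rw [h2] at h1
    calc 2 * d * (1 + (d : ℝ) ^ 2 / 16) ^ (-(d / 4) - 1 : ℝ) * (r ^ d)⁻¹
        = 2 * d * r ^ 4 * ((r ^ d)⁻¹ / r ^ 4 * (1 + d ^ 2 / 16) ^ (-(d / 4) - 1 : ℝ)) := by
          field_simp
      _ ≤ _ := by gcongr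

/-! ### Averages over cubes -/

theorem isOpen_cube (d : ℕ) (R : ℝ) : IsOpen (cube d R) := by
  have h : cube d R = ⋂ i, (fun x : EuclideanSpace ℝ (Fin d) => x i) ⁻¹'
      Ioo (-(R / 2)) (R / 2) := by
    ext x; simp [cube]
  rw [h]
  exact isOpen_iInter_of_finite fun i => isOpen_Ioo.preimage (by fun_prop)

theorem cube_subset_cube {r R : ℝ} (h : r ≤ R) : cube d r ⊆ cube d R := fun x hx i =>
  ⟨by linarith [(hx i).1], by linarith [(hx i).2]⟩

theorem volume_real_cube {R : ℝ} (hR : 0 ≤ R) : volume.real (cube d R) = R ^ d := by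
  have h : cube d R = (MeasurableEquiv.toLp 2 (Fin d → ℝ)).symm ⁻¹'
      (univ.pi fun _ => Ioo (-(R / 2)) (R / 2)) := by
    ext x; simp [cube]
  rw [Measure.real, h, (EuclideanSpace.volume_preserving_symm_measurableEquiv_toLp
    (Fin d)).measure_preimage (MeasurableSet.univ_pi fun _ => measurableSet_Ioo).nullMeasurableSet,
    Real.volume_pi_Ioo_toReal fun _ => by linarith]
  simp

theorem setAverage_cube {R : ℝ} (hR : 0 ≤ R) (f : EuclideanSpace ℝ (Fin d) → ℝ) :
    ⨍ x in cube d R, f x = (R ^ d)⁻¹ * ∫ x in cube d R, f x := by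
  rw [setAverage_eq, volume_real_cube hR, smul_eq_mul]

/-- The mean value inequality for the square of a function that is harmonic in `U` and vanishes in
the rest of the large cube. -/
theorem exists_average_sq_le (d : ℕ) (hd : 1 ≤ d) :
    ∃ C > 0, ∀ (r R : ℝ), 0 < r → r ≤ R →
      ∀ (U : Set (EuclideanSpace ℝ (Fin d))) (u : EuclideanSpace ℝ (Fin d) → ℝ)
        (Du : EuclideanSpace ℝ (Fin d) → EuclideanSpace ℝ (Fin d)),
        IsOpen U → U ⊆ cube d R → (∀ x ∈ cube d R, UniformConeAt U x) →
        MemW12 (cube d R) u Du → IsWeaklyHarmonic U Du →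
        (∀ᵐ x, x ∈ cube d R \ U → u x = 0) →
        ⨍ x in cube d r, u x ^ 2 ≤ C * ⨍ x in cube d R, u x ^ 2 := by
  obtain ⟨c, hc, C, hC, H⟩ := exists_testFunction_laplacian d hd
  have hd0 : (0 : ℝ) < d := by exact_mod_cast hd
  refine ⟨max (C / c) ((2 * d) ^ d), by positivity, ?_⟩
  intro r R hr hrR U u Du hU hUR hcone hu hharm hzero
  have hR : 0 < R := hr.trans_le hrR
  have hint : IntegrableOn (fun x => u x ^ 2) (cube d R) := hu.memLp.integrable_sq
  have hI : 0 ≤ ∫ x in cube d R, u x ^ 2 := integral_nonneg fun x => sq_nonneg _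
  rw [setAverage_cube hr.le, setAverage_cube hR.le]
  -- The second constant covers the range `R < 2 d r`, where no test function is needed.
  rcases le_or_gt (2 * d * r) R with hsmall | hlarge
  · obtain ⟨φ, hφ, hφ0, hup, hdown⟩ := H r R hr hsmall
    have hsub := integral_sq_mul_laplacian_nonneg (isOpen_cube d R) hU hUR hcone hu hharm hzero
      hφ hφ0
    have hind : IntegrableOn ((cube d r).indicator fun x => c * (r ^ d)⁻¹ * u x ^ 2)
        (cube d R) :=
      (hint.const_mul _).indicator (isOpen_cube d r).measurableSet
    have hle : ∫ x in cube d R, u x ^ 2 *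
        ∑ i, fderiv ℝ (fun y => fderiv ℝ φ y (EuclideanSpace.single i 1)) x
          (EuclideanSpace.single i 1) ≤
        ∫ x in cube d R, (C * (R ^ d)⁻¹ * u x ^ 2 -
          (cube d r).indicator (fun x => c * (r ^ d)⁻¹ * u x ^ 2) x) := by
      refine integral_mono ?_ ((hint.const_mul _).sub hind) fun x => ?_
      · simp only [Finset.mul_sum]
        exact integrable_finsetSum _ fun i _ =>
          hu.integrableOn_sq_mul_test (isOpen_cube d R).measurableSet
            ((hφ.fderiv_apply _).fderiv_apply _)
      · have hu2 := sq_nonneg (u x)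
        by_cases hx : x ∈ cube d r
        · have h1 := mul_le_mul_of_nonneg_left (hdown x hx) hu2
          have h2 : 0 ≤ C * (R ^ d)⁻¹ * u x ^ 2 := by positivity
          simp only [indicator_of_mem hx]
          linarith
        · have h1 := mul_le_mul_of_nonneg_left (hup x) hu2
          simp only [indicator_of_notMem hx]
          linarith
    rw [integral_sub (hint.const_mul _) hind, integral_const_mul,
      setIntegral_indicator (isOpen_cube d r).measurableSet,
      inter_eq_self_of_subset_right (cube_subset_cube hrR), integral_const_mul] at hle
    have h3 : (r ^ d)⁻¹ * ∫ x in cube d r, u x ^ 2 ≤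
        C / c * ((R ^ d)⁻¹ * ∫ x in cube d R, u x ^ 2) := by
      rw [div_mul_eq_mul_div, le_div_iff₀ hc]
      linarith
    refine h3.trans ?_
    gcongr
    exact le_max_left _ _
  · have h1 : ∫ x in cube d r, u x ^ 2 ≤ ∫ x in cube d R, u x ^ 2 :=
      setIntegral_mono_set hint (ae_of_all _ fun x => sq_nonneg _)
        (cube_subset_cube hrR).eventuallyLE
    have h2 : (r ^ d)⁻¹ ≤ (2 * d) ^ d * (R ^ d)⁻¹ := by
      rw [← div_eq_mul_inv, inv_le_iff_one_le_mul₀ (by positivity), div_mul_eq_mul_div,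
        one_le_div (by positivity), ← mul_pow]
      gcongr
    calc (r ^ d)⁻¹ * ∫ x in cube d r, u x ^ 2
        ≤ ((2 * d) ^ d * (R ^ d)⁻¹) * ∫ x in cube d R, u x ^ 2 := by
          gcongr
      _ = (2 * d) ^ d * ((R ^ d)⁻¹ * ∫ x in cube d R, u x ^ 2) := by ring
      _ ≤ _ := by
          gcongr
          exact le_max_right _ _

end Perforated

theorem theorem2p1 (d : ℕ) (hd : 2 ≤ d) :
    ∃ C : ℝ, 0 < C ∧
      ∀ (c₀ : ℝ) (T : Set (EuclideanSpace ℝ (Fin d))), 0 < c₀ → Perforated.IsHole c₀ T →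
      ∀ ε η R : ℝ, 0 < ε → ε ≤ 1 → 0 < η → η ≤ 1 → ε ≤ R →
      ∀ (u : EuclideanSpace ℝ (Fin d) → ℝ)
        (Du : EuclideanSpace ℝ (Fin d) → EuclideanSpace ℝ (Fin d)),
        Perforated.MemW12 (Perforated.cube d R) u Du →
        Perforated.IsWeaklyHarmonic
          (Perforated.cube d R ∩ Perforated.perforated T ε η) Du →
        (∀ᵐ x ∂volume, x ∈ Perforated.cube d R \ Perforated.perforated T ε η → u x = 0) →
        ∀ r : ℝ, ε ≤ r → r ≤ R →
          √(⨍ x in Perforated.cube d r, |u x| ^ 2) ≤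
            C * √(⨍ x in Perforated.cube d R, |u x| ^ 2) := by
  obtain ⟨C, hC, H⟩ := Perforated.exists_average_sq_le d (by omega)
  refine ⟨√C, Real.sqrt_pos.2 hC, ?_⟩
  intro c₀ T hc₀ hT ε η R hε _ hη hη1 _ u Du hu hharm hzero r hεr hrR
  simp only [sq_abs]
  rw [← Real.sqrt_mul hC.le]
  refine Real.sqrt_le_sqrt (H r R (hε.trans_le hεr) hrR _ u Du
    ((Perforated.isOpen_cube d R).inter (Perforated.isOpen_perforated hc₀ hT hε hη hη1))
    Set.inter_subset_left (fun x hx => ?_) hu hharm ?_)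
  · refine (Perforated.uniformConeAt_perforated hc₀ hT hε hη hη1 x).congr ?_
    filter_upwards [(Perforated.isOpen_cube d R).mem_nhds hx] with y hy
    simp [hy]
  · filter_upwards [hzero] with x hx hxR
    exact hx ⟨hxR.1, fun h => hxR.2 ⟨hxR.1, h⟩⟩
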